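/- A transducer over the input alphabet $\Sigma_I$ and the output alphabet $\Sigma_O$ consists of a finite state set $Q$, an initial state $q_0\in Q$, a transition function $\delta:Q\times\Sigma_I\to Q$ and a labelling $\ell:Q\to\Sigma_O$. Its output on a word $w\in\Sigma_I^*$ with run $q_0,q_1,\dots,q_n$ is $\mathcal T(w)=\ell(q_1)\cdots\ell(q_n)$. For $k>0$, a word is a $k$-round word if its length is divisible by $k$; its rounds are its consecutive blocks of length $k$. Two $k$-round words $x,y$ of the same length are $k$-round equivalent, written $x\asymp_k y$, if for every $r$ the $r$-th round of $y$ is a permutation of the $r$-th round of $x$. For $\Lambda\subseteq\Sigma_I^*$ write $\mathcal T_1\prec_{k,\Lambda}\mathcal T_2$ if for every $k$-round word $x\in\Lambda$ there is a $k$-round word $x'\in\Sigma_I^*$ with $x\asymp_k x'$ and $\mathcal T_1(x)\asymp_k\mathcal T_2(x')$, and write $\mathcal T_1\equiv_{k,\Lambda}\mathcal T_2$ if $\mathcal T_1\prec_{k,\Lambda}\mathcal T_2$ and $\mathcal T_2\prec_{k,\Lambda}\mathcal T_1$. **Theorem.** The problem of deciding, given transducers $\mathcal T_1,\mathcal T_2$,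 whether $\mathcal T_1\equiv_{k,\Lambda}\mathcal T_2$ is PSPACE-hard (under polynomial-time many-one reductions), even for fixed $k$ and $\Lambda$, namely for $k=2$, $\Sigma_I=\{a,b,c,d\}$ and $\Lambda=(ab+cd)^*$, a language which is recognized by a DFA with $4$ states, and for a two-letter output alphabet $\Sigma_O$. -/

import Mathlib

namespace RoundSim

/-! ### Turing machines and polynomial space -/

/-- A deterministic single-tape Turing machine with input alphabet `α`, state set `Q` and tape
alphabet `Γ`. The tape is infinite to the right only. -/
structure TuringMachine (α Q Γ : Type) where
  /-- the input alphabet is part of the tape alphabet -/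
  input : α ↪ Γ
  /-- the blank symbol, which is not an input letter -/
  blank : Γ
  input_ne_blank : ∀ a, input a ≠ blank
  start : Q
  accept : Q
  reject : Q
  accept_ne_reject : accept ≠ reject
  /-- the transition function: new state, symbol written, direction of the head move -/
  trans : Q → Γ → Q × Γ × Turing.Dir

namespace TuringMachine

variable {α Q Γ : Type}

/-- A configuration: the current state, the head position and the tape contents. -/
structure Cfg (Q Γ : Type) where
  state : Q
  head : ℕ
  tape : ℕ → Γ

/-- The head move. A left move in the leftmost cell leaves the head where it is. -/
def moveHead (i : ℕ) : Turing.Dir → ℕ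
  | Turing.Dir.left => i - 1
  | Turing.Dir.right => i + 1

/-- The initial configuration: the input is written at the left end of an otherwise blank tape. -/
def init (M : TuringMachine α Q Γ) (x : List α) : Cfg Q Γ where
  state := M.start
  head := 0
  tape i := ((x.map M.input)[i]?).getD M.blank

open Classical in
/-- One step of the machine. A machine in the accepting or the rejecting state has halted. -/
noncomputable def step (M : TuringMachine α Q Γ) (c : Cfg Q Γ) : Cfg Q Γ :=
  if c.state = M.accept ∨ c.state = M.reject then c
  else
    { state := (M.trans c.state (c.tape c.head)).1
      head := moveHead c.head (M.trans c.state (c.tape c.head)).2.2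
      tape := Function.update c.tape c.head (M.trans c.state (c.tape c.head)).2.1 }

/-- The configuration reached on the input `x` after `t` steps. -/
noncomputable def run (M : TuringMachine α Q Γ) (x : List α) (t : ℕ) : Cfg Q Γ :=
  M.step^[t] (M.init x)

/-- `M` decides `L`: it halts on all inputs, and it accepts exactly the words of `L`. -/
def Decides (M : TuringMachine α Q Γ) (L : Language α) : Prop :=
  ∀ x, (x ∈ L → ∃ t, (M.run x t).state = M.accept) ∧
    (x ∉ L → ∃ t, (M.run x t).state = M.reject)

/-- `M` runs in space `s`: on inputs of length `n` it only visits the first `s n` tape cells. -/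
def RunsInSpace (M : TuringMachine α Q Γ) (s : ℕ → ℕ) : Prop :=
  ∀ x t, (M.run x t).head < s x.length

end TuringMachine

/-- The class PSPACE: languages decided by a Turing machine in polynomial space. -/
def InPSPACE {α : Type} (L : Language α) : Prop :=
  ∃ (Q Γ : Type) (_ : Finite Q) (_ : Finite Γ) (M : TuringMachine α Q Γ) (p : Polynomial ℕ),
    M.Decides L ∧ M.RunsInSpace fun n => p.eval n

/-- Polynomial-time many-one (Karp) reducibility between languages. -/
def PolyTimeReducible {α β : Type} (L : Language α) (P : Language β) : Prop :=
  ∃ f : List α → List β,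
    Nonempty (Turing.TM2ComputableInPolyTime (id : List α → List α) (id : List β → List β) f) ∧
      ∀ x, x ∈ L ↔ f x ∈ P

/-- PSPACE-hardness: every language in PSPACE, over any finite alphabet, reduces to `P` in
polynomial time. -/
def PSPACEHard {β : Type} (P : Language β) : Prop :=
  ∀ (α : Type) [Finite α] (L : Language α), InPSPACE L → PolyTimeReducible L P

/-! ### Transducers -/

/-- An `α`/`β` transducer with state set `Q`. -/
structure Transducer (α β Q : Type) where
  start : Q
  step : Q → α → Q
  label : Q → β

/-- The output on a word when started in the state `q`: the labels of the states visited, without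
the label of `q` itself. -/
def Transducer.outputFrom {α β Q : Type} (T : Transducer α β Q) : Q → List α → List β
  | _, [] => []
  | q, a :: w => T.label (T.step q a) :: T.outputFrom (T.step q a) w

/-- The output of a transducer on a word. -/
def Transducer.output {α β Q : Type} (T : Transducer α β Q) (w : List α) : List β :=
  T.outputFrom T.start w

/-! ### Round simulation and round equivalence -/

/-- The Parikh vector of a word. -/
def parikh {α : Type} [DecidableEq α] (w : List α) : α → ℕ := fun a => w.count a

/-- `w` is a `k`-round word. -/
def IsRoundWord {α : Type} (k : ℕ) (w : List α) : Prop := ∃ R, w.length = k * R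

/-- The `r`-th round (of length `k`) of a word. -/
def round {α : Type} (k r : ℕ) (w : List α) : List α := (w.drop (r * k)).take k

/-- `x` and `y` are `k`-round equivalent: they are `k`-round words with the same number of rounds,
and corresponding rounds are permutations of each other. -/
def RoundEq {α : Type} [DecidableEq α] (k : ℕ) (x y : List α) : Prop :=
  ∃ R, x.length = k * R ∧ y.length = k * R ∧
    ∀ r < R, parikh (round k r x) = parikh (round k r y)

/-- `T₂` `k`-round simulates `T₁` restricted to `Λ`. -/
def RoundSimulates {α β Q₁ Q₂ : Type} [DecidableEq α] [DecidableEq β] (k : ℕ) (Λ : Language α)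
    (T₁ : Transducer α β Q₁) (T₂ : Transducer α β Q₂) : Prop :=
  ∀ x ∈ Λ, IsRoundWord k x →
    ∃ x', IsRoundWord k x' ∧ RoundEq k x x' ∧ RoundEq k (T₁.output x) (T₂.output x')

/-- `T₁` and `T₂` are `k`-round equivalent restricted to `Λ`. -/
def RoundEquivalent {α β Q₁ Q₂ : Type} [DecidableEq α] [DecidableEq β] (k : ℕ) (Λ : Language α)
    (T₁ : Transducer α β Q₁) (T₂ : Transducer α β Q₂) : Prop :=
  RoundSimulates k Λ T₁ T₂ ∧ RoundSimulates k Λ T₂ T₁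

/-! ### The decision problem -/

/-- The input alphabet `{a, b, c, d}`. -/
inductive Letter
  | a | b | c | d
  deriving DecidableEq

/-- The language `(ab + cd)*`. -/
def abcdStar : Language Letter :=
  (RegularExpression.star
    (RegularExpression.char Letter.a * RegularExpression.char Letter.b +
      RegularExpression.char Letter.c * RegularExpression.char Letter.d)).matches'

/-- A finite transducer over `{a, b, c, d}` with two output letters, as an input to an algorithm:
its states are `0, …, n - 1` (and `n ≠ 0`, as there is an initial state). -/
structure FinTransducer where
  n : ℕ
  T : Transducer Letter Bool (Fin n)

/-- The self-delimiting unary code of a number. -/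
def unary (m : ℕ) : List Bool := List.replicate m true ++ [false]

/-- The code of a state's line in the transition table: its four successors and its label. -/
def encodeRow {n : ℕ} (T : Transducer Letter Bool (Fin n)) (q : Fin n) : List Bool :=
  unary (T.step q Letter.a) ++ unary (T.step q Letter.b) ++ unary (T.step q Letter.c) ++
    unary (T.step q Letter.d) ++ [T.label q]

/-- The code of a transducer: the number of states, the initial state, the transition table.
As states are numbered below `n`, the length is polynomial in `n`. -/
def encodeTransducer (S : FinTransducer) : List Bool :=
  unary S.n ++ unary S.T.start ++ (List.finRange S.n).flatMap (encodeRow S.T)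

/-- The problem of deciding, given two transducers, whether they are `k`-round equivalent
restricted to `Λ`, as a language of binary words. -/
def roundEquivProblem (k : ℕ) (Λ : Language Letter) : Language Bool :=
  {w | ∃ S₁ S₂ : FinTransducer, w = encodeTransducer S₁ ++ encodeTransducer S₂ ∧
    RoundEquivalent k Λ S₁.T S₂.T}

/-! ### The codes are uniquely decodable -/

theorem unary_append_inj {m m' : ℕ} {u v : List Bool} (h : unary m ++ u = unary m' ++ v) :
    m = m' ∧ u = v := by
  induction m generalizing m' with
  | zero =>
    cases m' with
    | zero => simpa [unary] using h
    | succ m' => simp [unary, List.replicate_succ] at h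
  | succ m ih =>
    cases m' with
    | zero => simp [unary, List.replicate_succ] at h
    | succ m' =>
      have h' : unary m ++ u = unary m' ++ v := by
        simpa [unary, List.replicate_succ] using h
      obtain ⟨h₁, h₂⟩ := ih h'
      exact ⟨by rw [h₁], h₂⟩

theorem encodeRow_append_inj {n : ℕ} {T T' : Transducer Letter Bool (Fin n)} {q : Fin n}
    {u v : List Bool} (h : encodeRow T q ++ u = encodeRow T' q ++ v) :
    T.step q = T'.step q ∧ T.label q = T'.label q ∧ u = v := by
  simp only [encodeRow, List.append_assoc] at h
  obtain ⟨ha, h⟩ := unary_append_inj h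
  obtain ⟨hb, h⟩ := unary_append_inj h
  obtain ⟨hc, h⟩ := unary_append_inj h
  obtain ⟨hd, h⟩ := unary_append_inj h
  simp only [List.cons_append, List.nil_append, List.cons.injEq] at h
  refine ⟨?_, h.1, h.2⟩
  funext s
  cases s
  · exact Fin.ext ha
  · exact Fin.ext hb
  · exact Fin.ext hc
  · exact Fin.ext hd

theorem flatMap_encodeRow_append_inj {n : ℕ} {T T' : Transducer Letter Bool (Fin n)}
    {u v : List Bool} (l : List (Fin n))
    (h : l.flatMap (encodeRow T) ++ u = l.flatMap (encodeRow T') ++ v) :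
    (∀ q ∈ l, T.step q = T'.step q ∧ T.label q = T'.label q) ∧ u = v := by
  induction l with
  | nil => exact ⟨by simp, by simpa using h⟩
  | cons q l ih =>
    simp only [List.flatMap_cons, List.append_assoc] at h
    obtain ⟨h₁, h₂, h₃⟩ := encodeRow_append_inj h
    obtain ⟨h₄, h₅⟩ := ih h₃
    refine ⟨?_, h₅⟩
    intro p hp
    rcases List.mem_cons.1 hp with rfl | hp
    · exact ⟨h₁, h₂⟩
    · exact h₄ p hp

theorem encodeTransducer_append_inj {S S' : FinTransducer} {u v : List Bool}
    (h : encodeTransducer S ++ u = encodeTransducer S' ++ v) : S = S' ∧ u = v := by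
  obtain ⟨n, T⟩ := S
  obtain ⟨n', T'⟩ := S'
  simp only [encodeTransducer, List.append_assoc] at h
  obtain ⟨hn, h⟩ := unary_append_inj h
  subst hn
  obtain ⟨hs, h⟩ := unary_append_inj h
  obtain ⟨hT, huv⟩ := flatMap_encodeRow_append_inj _ h
  refine ⟨?_, huv⟩
  have hT' : T = T' := by
    obtain ⟨s, f, l⟩ := T
    obtain ⟨s', f', l'⟩ := T'
    have h₁ : s = s' := Fin.ext hs
    have h₂ : f = f' := funext fun q => (hT q (List.mem_finRange q)).1
    have h₃ : l = l' := funext fun q => (hT q (List.mem_finRange q)).2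
    rw [h₁, h₂, h₃]
  rw [hT']

end RoundSim

/-!
A round `ab` or `cd` of an input word `x` carries a bit, and the word `x'` that answers `x` may only
choose the order of the letters in each round. So, if the other transducer outputs only `false`, a
transducer is read as a nondeterministic automaton whose runs survive as long as they visit no
state labelled `true` (`Transducer.Survives`); the question whether every bit sequence has a surviving run is
hard by the argument that proves the intersection problem for finite automata to be PSPACE-hard.

Given a machine `M` in polynomial space and an input, the automaton has one token for each of the
polynomially many tape cells and one token for the head; its nondeterminism only serves to choose
the token that is followed. A clock that runs cyclically through all cells and all instructions
`(q, y)` selects the current cell and instruction; the bit `true` fires the instruction, which is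
the claim that the head is there in state `q` and reads `y`. A token that notices a false claim
moves to a sink and survives (`survives_head_mismatch`, `survives_cell_mismatch`), while true claims
let the tokens follow the computation (`survives_fire`). Firing the rejecting state kills all
tokens. Hence a bit sequence without survivors is the same as a rejecting computation
(`exists_token_survives`, `killable_of_reject`).

The two transducers differ only in their initial states. In the first round the first one goes to
the sink if the round is in the order of `(ab + cd)*`, and otherwise it does what the second one
does on that order. So the second transducer is always simulated by the first one, and the converse holds if
and only if every bit sequence is survived (`roundEquivalent_iff_survives`).

For the reduction, the transition table consists of one block for each value of the clock's slot.
Apart from one tape symbol, a block is a fixed sequence of unary numbers of the form `a` or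
`a + B * c`, where `c` is a loop counter (`encodeTransducer_sim`). Such a table is printed by a
program with nested loops over counters and stacks; programs in a small structured language for
such loops are compiled to `Turing.FinTM2` without loss of time (`iterate_step_of_exec`).
-/

namespace RoundSim

/-! ### Words over `{a, b, c, d}` as bit lists with a choice of order in each round -/

/-- The word of `(ab + cd)*` given by a list of bits: `ab` for `false` and `cd` for `true`. -/
def word (bits : List Bool) : List Letter :=
  bits.flatMap fun b => if b then [Letter.c, Letter.d] else [Letter.a, Letter.b]

/-- The letter of the round with bit `b` that comes first when the order `o` is chosen; the
other letter is `roundLetter b (!o)`. -/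
def roundLetter : Bool → Bool → Letter
  | false, false => Letter.a
  | false, true => Letter.b
  | true, false => Letter.c
  | true, true => Letter.d

theorem word_cons (b : Bool) (bits : List Bool) :
    word (b :: bits) = roundLetter b false :: roundLetter b true :: word bits := by
  cases b <;> simp [word, roundLetter]

theorem mem_abcdStar {w : List Letter} : w ∈ abcdStar ↔ ∃ bits, w = word bits := by
  simp only [abcdStar, RegularExpression.matches', Language.mem_kstar]
  constructor
  · rintro ⟨L, rfl, hL⟩
    induction L with
    | nil => exact ⟨[], rfl⟩
    | cons y L ih =>
      obtain ⟨bits, hb⟩ := ih fun y hy => hL y (List.mem_cons_of_mem _ hy)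
      have hy := hL y List.mem_cons_self
      rw [Language.mem_add, Language.mem_mul, Language.mem_mul] at hy
      rcases hy with ⟨p, rfl, q, rfl, rfl⟩ | ⟨p, rfl, q, rfl, rfl⟩
      · exact ⟨false :: bits, by simp [word_cons, roundLetter, hb]⟩
      · exact ⟨true :: bits, by simp [word_cons, roundLetter, hb]⟩
  · rintro ⟨bits, rfl⟩
    refine ⟨bits.map fun b => if b then [Letter.c, Letter.d] else [Letter.a, Letter.b],
      by simp [word, List.flatMap], ?_⟩
    intro y hy
    rw [Language.mem_add, Language.mem_mul, Language.mem_mul]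
    obtain ⟨b, -, rfl⟩ := List.mem_map.1 hy
    cases b
    · exact Or.inl ⟨[Letter.a], rfl, [Letter.b], rfl, rfl⟩
    · exact Or.inr ⟨[Letter.c], rfl, [Letter.d], rfl, rfl⟩

/-- The minimal automaton of `(ab + cd)*`: state `1` is reached after `a`, state `2` after `c`,
and state `3` is a sink. -/
def abcdDFA : DFA Letter (Fin 4) where
  step
    | 0, Letter.a => 1
    | 0, Letter.c => 2
    | 1, Letter.b => 0
    | 2, Letter.d => 0
    | _, _ => 3
  start := 0
  accept := {0}

theorem abcdDFA_sink (w : List Letter) : abcdDFA.evalFrom 3 w = 3 := by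
  induction w with
  | nil => rfl
  | cons l w ih => exact ih

theorem abcdDFA_evalFrom_word (bits : List Bool) : abcdDFA.evalFrom 0 (word bits) = 0 := by
  induction bits with
  | nil => rfl
  | cons b bits ih => rw [word_cons]; cases b <;> exact ih

theorem exists_word_of_evalFrom :
    ∀ w : List Letter, abcdDFA.evalFrom 0 w = 0 → ∃ bits, w = word bits
  | [], _ => ⟨[], rfl⟩
  | [l], h => by cases l <;> exact absurd h (by decide)
  | l :: l' :: w, h => by
    have sink : ∀ v, abcdDFA.evalFrom 3 v ≠ 0 := fun v => by rw [abcdDFA_sink]; decide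
    have key : (l = Letter.a ∧ l' = Letter.b ∨ l = Letter.c ∧ l' = Letter.d) ∧
        abcdDFA.evalFrom 0 w = 0 := by
      cases l <;> cases l' <;> first | exact absurd h (sink w) | exact ⟨by simp, h⟩
    obtain ⟨hl, hw⟩ := key
    obtain ⟨bits, rfl⟩ := exists_word_of_evalFrom w hw
    rcases hl with ⟨rfl, rfl⟩ | ⟨rfl, rfl⟩
    · exact ⟨false :: bits, by rw [word_cons]; rfl⟩
    · exact ⟨true :: bits, by rw [word_cons]; rfl⟩

theorem abcdDFA_accepts : abcdDFA.accepts = abcdStar := by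
  ext w
  rw [mem_abcdStar]
  constructor
  · exact fun h => exists_word_of_evalFrom w h
  · rintro ⟨bits, rfl⟩
    exact abcdDFA_evalFrom_word bits

/-! ### Rounds of length two -/

theorem round_two_zero {α : Type} (p q : α) (x : List α) : round 2 0 (p :: q :: x) = [p, q] := by
  simp [round]

theorem round_two_succ {α : Type} (r : ℕ) (p q : α) (x : List α) :
    round 2 (r + 1) (p :: q :: x) = round 2 r x := by
  simp [round, Nat.add_mul]

theorem roundEq_nil_left {α : Type} [DecidableEq α] {y : List α} :
    RoundEq 2 [] y ↔ y = [] := by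
  constructor
  · rintro ⟨R, h, h', -⟩
    have : R = 0 := by simpa using h
    subst this
    simpa using h'
  · rintro rfl
    exact ⟨0, by simp⟩

theorem roundEq_cons_left {α : Type} [DecidableEq α] {p q : α} {x y : List α} :
    RoundEq 2 (p :: q :: x) y ↔
      ∃ p' q' y', y = p' :: q' :: y' ∧ parikh [p, q] = parikh [p', q'] ∧ RoundEq 2 x y' := by
  constructor
  · rintro ⟨R, hx, hy, h⟩
    obtain ⟨S, rfl⟩ : ∃ S, R = S + 1 := ⟨R - 1, by simp at hx; omega⟩
    match y, hy with
    | p' :: q' :: y', hy =>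
      refine ⟨p', q', y', rfl, ?_, S, ?_, ?_, fun r hr => ?_⟩
      · simpa [round_two_zero] using h 0 (by omega)
      · simp at hx; omega
      · simp at hy; omega
      · simpa [round_two_succ] using h (r + 1) (by omega)
    | [_], hy => simp at hy; omega
    | [], hy => simp at hy
  · rintro ⟨p', q', y', rfl, hp, S, hx, hy, h⟩
    refine ⟨S + 1, by simp [hx]; ring, by simp [hy]; ring, fun r hr => ?_⟩
    cases r with
    | zero => simpa [round_two_zero] using hp
    | succ r => simpa [round_two_succ] using h r (by omega)

theorem roundEq_length {α : Type} [DecidableEq α] {k : ℕ} {x y : List α} (h : RoundEq k x y) :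
    x.length = y.length := by
  obtain ⟨R, hx, hy, -⟩ := h
  rw [hx, hy]

/-- The two letters of a round are distinct, so a round has exactly two orderings. -/
theorem parikh_pair_letter {b : Bool} {p q : Letter} :
    parikh [roundLetter b false, roundLetter b true] = parikh [p, q] ↔
      ∃ o, p = roundLetter b o ∧ q = roundLetter b (!o) := by
  constructor
  · intro h
    have ha := congrFun h Letter.a
    have hb := congrFun h Letter.b
    have hc := congrFun h Letter.c
    have hd := congrFun h Letter.d
    cases b <;> cases p <;> cases q <;>
      simp [parikh, roundLetter] at ha hb hc hd <;> decide
  · rintro ⟨o, rfl, rfl⟩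
    cases o
    · rfl
    · funext l
      simp [parikh, List.count_cons]
      omega

theorem parikh_pair_false {p q : Bool} :
    parikh [false, false] = parikh [p, q] ↔ p = false ∧ q = false := by
  constructor
  · intro h
    have := congrFun h true
    cases p <;> cases q <;> simp [parikh] at this ⊢
  · rintro ⟨rfl, rfl⟩
    rfl

theorem roundEq_of_forall_false : ∀ {x y : List Bool}, (∀ l ∈ x, l = false) →
    (RoundEq 2 x y ↔ Even x.length ∧ y.length = x.length ∧ ∀ l ∈ y, l = false)
  | [], y, _ => by simp [roundEq_nil_left]; rintro rfl; simp
  | [p], y, _ => by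
    simp only [List.length_singleton, Nat.not_even_one, false_and, iff_false]
    rintro ⟨R, h, -⟩
    simp at h; omega
  | p :: q :: x, y, h => by
    obtain rfl : p = false := h p (by simp)
    obtain rfl : q = false := h q (by simp)
    have ih := fun y => roundEq_of_forall_false (x := x) (y := y) fun l hl => h l (by simp [hl])
    rw [roundEq_cons_left]
    constructor
    · rintro ⟨p', q', y', rfl, hp, hy⟩
      obtain ⟨rfl, rfl⟩ := parikh_pair_false.1 hp
      obtain ⟨h₁, h₂, h₃⟩ := (ih y').1 hy
      refine ⟨?_, by simp [h₂], by simpa using h₃⟩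
      simpa [Nat.even_add_one] using h₁
    · rintro ⟨h₁, h₂, h₃⟩
      match y, h₂ with
      | p' :: q' :: y', h₂ =>
        refine ⟨p', q', y', rfl, parikh_pair_false.2 ⟨h₃ _ (by simp), h₃ _ (by simp)⟩,
          (ih y').2 ⟨?_, by simpa using h₂, fun l hl => h₃ l (by simp [hl])⟩⟩
        simpa [Nat.even_add_one] using h₁
      | [_], h₂ => simp at h₂
      | [], h₂ => simp at h₂

theorem length_outputFrom {α β Q : Type} (T : Transducer α β Q) (w : List α) :
    ∀ q, (T.outputFrom q w).length = w.length := by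
  induction w with
  | nil => exact fun _ => rfl
  | cons a w ih => intro q; simp [Transducer.outputFrom, ih]

theorem length_word (bits : List Bool) : (word bits).length = 2 * bits.length := by
  induction bits with
  | nil => rfl
  | cons b bits ih => rw [word_cons]; simp [ih]; ring

/-! ### Survival: the nondeterministic reading of a transducer -/

/-- From the state `p`, the rounds given by `bits` can be ordered in such a way that the
transducer visits only states labelled `false`, `p` included. -/
def Transducer.Survives {Q : Type} (T : Transducer Letter Bool Q) : Q → List Bool → Prop
  | p, [] => T.label p = false
  | p, b :: bits => T.label p = false ∧ ∃ o, T.label (T.step p (roundLetter b o)) = false ∧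
      T.Survives (T.step (T.step p (roundLetter b o)) (roundLetter b (!o))) bits

theorem survives_iff {Q : Type} (T : Transducer Letter Bool Q) (bits : List Bool) : ∀ p,
    T.Survives p bits ↔ T.label p = false ∧
      ∃ x', RoundEq 2 (word bits) x' ∧ ∀ l ∈ T.outputFrom p x', l = false := by
  induction bits with
  | nil =>
    intro p
    have : word [] = [] := rfl
    simp [Transducer.Survives, this, roundEq_nil_left, Transducer.outputFrom]
  | cons b bits ih =>
    intro p
    rw [Transducer.Survives, word_cons]
    refine and_congr_right fun _ => ?_
    constructor
    · rintro ⟨o, h₁, h₂⟩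
      obtain ⟨h₂, x', hx, hl⟩ := (ih _).1 h₂
      refine ⟨roundLetter b o :: roundLetter b (!o) :: x', roundEq_cons_left.2
        ⟨_, _, _, rfl, parikh_pair_letter.2 ⟨o, rfl, rfl⟩, hx⟩, ?_⟩
      simpa [Transducer.outputFrom] using ⟨h₁, h₂, by simpa using hl⟩
    · rintro ⟨x', hx, hl⟩
      obtain ⟨p', q', y', rfl, hp, hy⟩ := roundEq_cons_left.1 hx
      obtain ⟨o, rfl, rfl⟩ := parikh_pair_letter.1 hp
      have h₁ := hl _ (by rw [Transducer.outputFrom]; exact List.mem_cons_self)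
      have h₂ := hl (T.label (T.step (T.step p (roundLetter b o)) (roundLetter b (!o))))
        (by simp [Transducer.outputFrom])
      exact ⟨o, h₁, (ih _).2 ⟨h₂, y', hy, fun l hl' => hl l (by simp [Transducer.outputFrom, hl'])⟩⟩

/-! ### The transducers that simulate a Turing machine -/

/-- The part of a token that does not concern the clock. -/
inductive Role (Q G : Type)
  /-- watches one tape cell and knows its contents; the flag marks the leftmost cell -/
  | cell (x : G × Bool)
  /-- watches the head and knows the state of the machine -/
  | head (q : Q)
  /-- becomes the head token at the end of the first cycle -/
  | pre
  /-- passes along the cells during the first cycle and may become the token of each of them -/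
  | chain
  /-- the chain, after it has declined to become the token of the current cell -/
  | choice
  deriving Fintype

/-- The slot of a target relative to the slot `k` of its source. -/
inductive Slot
  | cur | prev | zero | one

/-- The slot denoted by a relative slot. Slots are cyclic: the slot before `0` is `D`. -/
def Slot.eval {D : ℕ} (k : Fin (D + 1)) : Slot → Fin (D + 1)
  | cur => k
  | prev => k - 1
  | zero => 0
  | one => 1

/-- The states of the transducers: six special states and the tokens. A token consists of the
number of slots until its own slot, the current instruction of the slot, and a role. -/
abbrev SimState (D m : ℕ) (Q G : Type) := Fin 6 ⊕ Fin (D + 1) × Fin (m + 1) × Role Q G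

/-- The successor of a token, with its slot given relative to the slot of the token. -/
abbrev Target (m : ℕ) (Q G : Type) := Fin 6 ⊕ Slot × Fin (m + 1) × Role Q G

/-- The state denoted by a target. -/
def Target.eval {D m : ℕ} {Q G : Type} (k : Fin (D + 1)) : Target m Q G → SimState D m Q G
  | Sum.inl i => Sum.inl i
  | Sum.inr (s, p) => Sum.inr (s.eval k, p)

/-- The target with role `s` whose clock is advanced by one. -/
def Target.tick {m : ℕ} {Q G : Type} (u : Fin (m + 1)) (s : Role Q G) : Target m Q G :=
  Sum.inr (if u = 0 then Slot.prev else Slot.cur, u - 1, s)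

/-- The bit read by a token in a round: `a` and `c` carry a bit, `b` and `d` do not. -/
def bitOf : Letter → Option Bool
  | Letter.a => some false
  | Letter.c => some true
  | _ => none

section

variable {α Q G : Type} {D m : ℕ} (M : TuringMachine α Q G)
  (ins : Fin (m + 1) ≃ Option (Q × G × Bool))

open Classical in
/-- The successor of a token when a bit is read. Each clock value `u` of a slot stands for the
instruction `ins u`; `none` is never fired legitimately, and it is the last one of each slot, so
that the clock stays in the same slot when an instruction is fired. The bit `true` fires the
current instruction `(q, y)`, which claims that in the current slot there is a head in state `q`
reading `y`. The flag `z` says whether the current slot is the token's own one, and `w` is the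
initial contents of the cell met by the chain. -/
noncomputable def tokenStep (z : Bool) (w : G × Bool) (u : Fin (m + 1)) :
    Role Q G → Bool → Target m Q G
  | Role.cell x, false => Target.tick u (Role.cell x)
  | Role.cell x, true =>
    match ins u with
    | none => Sum.inl 1
    | some (q, y) =>
      if q = M.reject then Sum.inl 0
      else if z then
        if x = y then Target.tick u (Role.cell ((M.trans q y.1).2.1, y.2)) else Sum.inl 1
      else Target.tick u (Role.cell x)
  | Role.head q, false => Target.tick u (Role.head q)
  | Role.head q, true =>
    match ins u with
    | none => Sum.inl 1
    | some (q', y) =>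
      if z = true ∧ q = q' ∧ q ≠ M.accept then
        if q = M.reject then Sum.inl 0
        else Sum.inr
          (match (M.trans q y.1).2.2 with
            | Turing.Dir.right => Slot.one
            | Turing.Dir.left => if y.2 then Slot.zero else Slot.prev,
          u - 1, Role.head (M.trans q y.1).1)
      else Sum.inl 1
  | Role.pre, true => Sum.inl 1
  | Role.pre, false =>
    if z = true ∧ u = 0 then Sum.inr (Slot.zero, Fin.last m, Role.head M.start)
    else Target.tick u Role.pre
  | Role.chain, _ =>
    if u = Fin.last m then Sum.inr (Slot.zero, u - 1, Role.cell w)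
    else if z = true ∧ u = 0 then Sum.inl 0
    else Target.tick u Role.chain
  | Role.choice, _ => Target.tick u Role.chain

open Classical in
/-- The successor of a token. Only the chain at the start of a slot reacts to `b` and `d`; hence
for all other tokens the order of the letters in a round is irrelevant. -/
noncomputable def tokenTarget (z : Bool) (w : G × Bool) (p : Fin (m + 1) × Role Q G)
    (l : Letter) : Target m Q G :=
  match bitOf l with
  | some b => tokenStep M ins z w p.1 p.2 b
  | none => Sum.inr (Slot.cur, p.1,
      if p.1 = Fin.last m ∧ p.2 = Role.chain then Role.choice else p.2)

/-- The successors of the special states; slots are relative to slot `0`. State `0` is the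
dead state and `1` a sink without further checks. States `2` and `3` are the initial states of the
two transducers; `4` and `5` lead to the chain and to the token of the head. -/
def specialTarget (i : Fin 6) (l : Letter) : Target m Q G :=
  match i with
  | 0 => Sum.inl 0
  | 1 => Sum.inl 1
  | 2 => if (bitOf l).isSome then Sum.inl 1 else Sum.inl 4
  | 3 => if (bitOf l).isSome then Sum.inl 4 else Sum.inl 5
  | 4 => Sum.inr (Slot.prev, Fin.last m, Role.chain)
  | 5 => Sum.inr (Slot.prev, Fin.last m, Role.pre)

/-- The transducer with `D + 1` slots and the given initial state for the machine `M`; `w` is the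
initial tape. During the first cycle the chain token meets the cells in increasing order while
its slot number decreases. -/
noncomputable def simTransducer (D : ℕ) (w : ℕ → G × Bool) (start : Fin 6) :
    Transducer Letter Bool (SimState D m Q G) where
  start := Sum.inl start
  step
    | Sum.inl i, l => (specialTarget i l).eval 0
    | Sum.inr (k, p), l => (tokenTarget M ins (k = 0) (w (D - k)) p l).eval k
  label
    | Sum.inl i => i = 0
    | Sum.inr _ => false

end

/-! ### Survival of the single states -/

theorem Transducer.Survives.label_eq {Q : Type} {T : Transducer Letter Bool Q} {p : Q}
    {bits : List Bool} (h : T.Survives p bits) : T.label p = false := by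
  cases bits with
  | nil => exact h
  | cons => exact h.1

/-- If the second letters `b` and `d` change neither `p` nor its successor, then both orders of a
round lead to the same state. -/
theorem survives_cons_of_order_irrelevant {Q : Type} {T : Transducer Letter Bool Q} {p : Q}
    {b : Bool} (hl : T.label p = false) (hp : T.step p (roundLetter b true) = p)
    (hp' : T.step (T.step p (roundLetter b false)) (roundLetter b true) =
      T.step p (roundLetter b false)) (bits : List Bool) :
    T.Survives p (b :: bits) ↔ T.Survives (T.step p (roundLetter b false)) bits := by
  rw [Transducer.Survives]
  constructor
  · rintro ⟨-, o, -, h⟩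
    cases o
    · simpa [hp'] using h
    · simpa [hp] using h
  · intro h
    exact ⟨hl, false, h.label_eq, by simpa [hp'] using h⟩

section

variable {α Q G : Type} {D m : ℕ} {M : TuringMachine α Q G}
  {ins : Fin (m + 1) ≃ Option (Q × G × Bool)} {w : ℕ → G × Bool} {i : Fin 6}

theorem not_survives_dead (bits : List Bool) :
    ¬ (simTransducer M ins D w i).Survives (Sum.inl 0) bits := fun h => by
  simpa [simTransducer] using h.label_eq

theorem survives_alive (bits : List Bool) :
    (simTransducer M ins D w i).Survives (Sum.inl 1) bits := by
  induction bits with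
  | nil => simp [Transducer.Survives, simTransducer]
  | cons b bits ih =>
    rw [survives_cons_of_order_irrelevant (by simp [simTransducer])]
    · exact ih
    · simp [simTransducer, specialTarget, Target.eval]
    · simp [simTransducer, specialTarget, Target.eval]

/-- States that do not react to `b` and `d`. -/
def OrderIrrelevant : SimState D m Q G → Prop
  | Sum.inl i => i = 0 ∨ i = 1
  | Sum.inr (_, u, s) => ¬ (u = Fin.last m ∧ s = Role.chain)

theorem step_of_orderIrrelevant {p : SimState D m Q G} (hp : OrderIrrelevant p) (b : Bool) :
    (simTransducer M ins D w i).step p (roundLetter b true) = p := by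
  rcases p with i | ⟨k, u, s⟩
  · rcases hp with rfl | rfl <;> rfl
  · have : bitOf (roundLetter b true) = none := by cases b <;> rfl
    simp only [OrderIrrelevant] at hp
    simp [simTransducer, tokenTarget, this, Target.eval, Slot.eval, hp]

theorem survives_token {k : Fin (D + 1)} {u : Fin (m + 1)} {s : Role Q G} {b : Bool}
    (hp : ¬ (u = Fin.last m ∧ s = Role.chain)) {t : Target m Q G}
    (ht : tokenStep M ins (k = 0) (w (D - k)) u s b = t)
    (ht' : OrderIrrelevant (t.eval k)) (bits : List Bool) :
    (simTransducer M ins D w i).Survives (Sum.inr (k, u, s)) (b :: bits) ↔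
      (simTransducer M ins D w i).Survives (t.eval k) bits := by
  have h : (simTransducer M ins D w i).step (Sum.inr (k, u, s)) (roundLetter b false) =
      t.eval k := by
    subst ht
    cases b <;> rfl
  rw [survives_cons_of_order_irrelevant rfl
    (step_of_orderIrrelevant (p := Sum.inr (k, u, s)) hp b), h]
  rw [h]
  exact step_of_orderIrrelevant ht' b

/-- The slot after one clock step. -/
def tickSlot (k : Fin (D + 1)) (u : Fin (m + 1)) : Fin (D + 1) := if u = 0 then k - 1 else k

theorem eval_tick (k : Fin (D + 1)) (u : Fin (m + 1)) (s : Role Q G) :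
    (Target.tick u s).eval k = Sum.inr (tickSlot k u, u - 1, s) := by
  unfold Target.tick tickSlot
  split_ifs <;> rfl

theorem survives_cell_false {k : Fin (D + 1)} {u : Fin (m + 1)} {x : G × Bool}
    (bits : List Bool) :
    (simTransducer M ins D w i).Survives (Sum.inr (k, u, Role.cell x)) (false :: bits) ↔
      (simTransducer M ins D w i).Survives (Sum.inr (tickSlot k u, u - 1, Role.cell x)) bits := by
  rw [survives_token (by simp) (t := Target.tick u (Role.cell x)) rfl] <;> rw [eval_tick]
  simp [OrderIrrelevant]

theorem survives_head_false {k : Fin (D + 1)} {u : Fin (m + 1)} {q : Q}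
    (bits : List Bool) :
    (simTransducer M ins D w i).Survives (Sum.inr (k, u, Role.head q)) (false :: bits) ↔
      (simTransducer M ins D w i).Survives (Sum.inr (tickSlot k u, u - 1, Role.head q)) bits := by
  rw [survives_token (by simp) (t := Target.tick u (Role.head q)) rfl] <;> rw [eval_tick]
  simp [OrderIrrelevant]

theorem not_survives_cell_reject {k : Fin (D + 1)} {u : Fin (m + 1)} {x y : G × Bool}
    (hu : ins u = some (M.reject, y)) (bits : List Bool) :
    ¬ (simTransducer M ins D w i).Survives (Sum.inr (k, u, Role.cell x)) (true :: bits) := by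
  rw [survives_token (by simp) (t := Sum.inl 0) (by simp [tokenStep, hu]) (Or.inl rfl)]
  exact not_survives_dead bits

theorem survives_cell_other {k : Fin (D + 1)} {u : Fin (m + 1)} {q : Q} {x y : G × Bool}
    (hu : ins u = some (q, y)) (hq : q ≠ M.reject) (hk : k ≠ 0) (bits : List Bool) :
    (simTransducer M ins D w i).Survives (Sum.inr (k, u, Role.cell x)) (true :: bits) ↔
      (simTransducer M ins D w i).Survives (Sum.inr (tickSlot k u, u - 1, Role.cell x)) bits := by
  rw [survives_token (by simp) (t := Target.tick u (Role.cell x)) (by simp [tokenStep, hu, hq, hk])]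
    <;> rw [eval_tick]
  simp [OrderIrrelevant]

theorem survives_cell_match {u : Fin (m + 1)} {q : Q} {x : G × Bool}
    (hu : ins u = some (q, x)) (hq : q ≠ M.reject) (bits : List Bool) :
    (simTransducer M ins D w i).Survives (Sum.inr (0, u, Role.cell x)) (true :: bits) ↔
      (simTransducer M ins D w i).Survives
        (Sum.inr (tickSlot 0 u, u - 1, Role.cell ((M.trans q x.1).2.1, x.2))) bits := by
  rw [survives_token (by simp) (t := Target.tick u (Role.cell ((M.trans q x.1).2.1, x.2)))
    (by simp [tokenStep, hu, hq])] <;> rw [eval_tick]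
  simp [OrderIrrelevant]

/-- The token of a cell catches an instruction that claims a wrong symbol in the cell. -/
theorem survives_cell_mismatch {u : Fin (m + 1)} {q : Q} {x y : G × Bool}
    (hu : ins u = some (q, y)) (hq : q ≠ M.reject) (hxy : x ≠ y) (bits : List Bool) :
    (simTransducer M ins D w i).Survives (Sum.inr (0, u, Role.cell x)) (true :: bits) := by
  rw [survives_token (by simp) (t := Sum.inl 1) (by simp [tokenStep, hu, hq, hxy]) (Or.inr rfl)]
  exact survives_alive bits

/-- The token of the head catches every instruction that is fired in a wrong slot or for a wrong
state of the machine. -/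
theorem survives_head_mismatch {k : Fin (D + 1)} {u : Fin (m + 1)} {q : Q}
    (h : ∀ y, ins u = some (q, y) → k = 0 → q = M.accept) (bits : List Bool) :
    (simTransducer M ins D w i).Survives (Sum.inr (k, u, Role.head q)) (true :: bits) := by
  rw [survives_token (by simp) (t := Sum.inl 1) ?_ (Or.inr rfl)]
  · exact survives_alive bits
  · rcases hu : ins u with _ | ⟨q', y⟩
    · simp [tokenStep, hu]
    · have : ¬ (k = 0 ∧ q = q' ∧ q ≠ M.accept) := by
        rintro ⟨hk, rfl, hq⟩
        exact hq (h y hu hk)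
      simp [tokenStep, hu, this]

theorem not_survives_head_reject {u : Fin (m + 1)} {y : G × Bool}
    (hu : ins u = some (M.reject, y)) (bits : List Bool) :
    ¬ (simTransducer M ins D w i).Survives (Sum.inr (0, u, Role.head M.reject)) (true :: bits) := by
  rw [survives_token (by simp) (t := Sum.inl 0)
    (by simp [tokenStep, hu, M.accept_ne_reject.symm]) (Or.inl rfl)]
  exact not_survives_dead bits

theorem survives_head_match {u : Fin (m + 1)} {q : Q} {y : G × Bool}
    (hu : ins u = some (q, y)) (hq : q ≠ M.accept) (hq' : q ≠ M.reject) (bits : List Bool) :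
    (simTransducer M ins D w i).Survives (Sum.inr (0, u, Role.head q)) (true :: bits) ↔
      (simTransducer M ins D w i).Survives
        (Sum.inr (match (M.trans q y.1).2.2 with
            | Turing.Dir.right => 1
            | Turing.Dir.left => if y.2 then 0 else -1,
          u - 1, Role.head (M.trans q y.1).1)) bits := by
  rw [survives_token (by simp) (t := Sum.inr
          (match (M.trans q y.1).2.2 with
            | Turing.Dir.right => Slot.one
            | Turing.Dir.left => if y.2 then Slot.zero else Slot.prev,
          u - 1, Role.head (M.trans q y.1).1)) (by simp [tokenStep, hu, hq, hq'])]
  · simp only [Target.eval]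
    rcases (M.trans q y.1).2.2
    · cases y.2 <;> simp [Slot.eval]
    · simp [Slot.eval]
  · simp [OrderIrrelevant, Target.eval]

theorem survives_pre_true {k : Fin (D + 1)} {u : Fin (m + 1)} (bits : List Bool) :
    (simTransducer M ins D w i).Survives (Sum.inr (k, u, Role.pre)) (true :: bits) := by
  rw [survives_token (by simp) (t := Sum.inl 1) rfl (Or.inr rfl)]
  exact survives_alive bits

theorem survives_pre_zero (bits : List Bool) :
    (simTransducer M ins D w i).Survives (Sum.inr (0, 0, Role.pre)) (false :: bits) ↔
      (simTransducer M ins D w i).Survives (Sum.inr (0, Fin.last m, Role.head M.start)) bits := by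
  rw [survives_token (by simp) (t := Sum.inr (Slot.zero, Fin.last m, Role.head M.start))
    (by simp [tokenStep])]
  · rfl
  · simp [OrderIrrelevant, Target.eval]

theorem survives_pre_false {k : Fin (D + 1)} {u : Fin (m + 1)} (h : ¬ (k = 0 ∧ u = 0))
    (bits : List Bool) :
    (simTransducer M ins D w i).Survives (Sum.inr (k, u, Role.pre)) (false :: bits) ↔
      (simTransducer M ins D w i).Survives (Sum.inr (tickSlot k u, u - 1, Role.pre)) bits := by
  rw [survives_token (by simp) (t := Target.tick u Role.pre) (by simp [tokenStep, h])] <;>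
    rw [eval_tick]
  simp [OrderIrrelevant]

theorem survives_choice (hm : m ≠ 0) {k : Fin (D + 1)} (b : Bool) (bits : List Bool) :
    (simTransducer M ins D w i).Survives (Sum.inr (k, Fin.last m, Role.choice)) (b :: bits) ↔
      (simTransducer M ins D w i).Survives (Sum.inr (k, Fin.last m - 1, Role.chain)) bits := by
  have h0 : Fin.last m ≠ 0 := by simpa [Fin.ext_iff] using hm
  have h1 : Fin.last m - 1 ≠ Fin.last m := by
    intro h
    have : (1 : Fin (m + 1)) = 0 := by simpa using h
    rw [Fin.ext_iff] at this
    simp [Nat.mod_eq_of_lt (show 1 < m + 1 by omega)] at this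
  rw [survives_token (by simp) (t := Target.tick (Fin.last m) Role.chain) rfl] <;>
    rw [eval_tick] <;> simp [tickSlot, h0, OrderIrrelevant, h1]

/-- At the start of a slot the order of the round decides whether the chain becomes the token of
the current cell. -/
theorem survives_chain_last (hm : m ≠ 0) {k : Fin (D + 1)} (b : Bool) (bits : List Bool) :
    (simTransducer M ins D w i).Survives (Sum.inr (k, Fin.last m, Role.chain)) (b :: bits) ↔
      (simTransducer M ins D w i).Survives
        (Sum.inr (0, Fin.last m - 1, Role.cell (w (D - k)))) bits ∨
      (simTransducer M ins D w i).Survives (Sum.inr (k, Fin.last m - 1, Role.chain)) bits := by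
  have h0 : Fin.last m ≠ 0 := by simpa [Fin.ext_iff] using hm
  have hb : ∀ b, bitOf (roundLetter b true) = none := by decide
  have hb' : ∀ b, bitOf (roundLetter b false) = some b := by decide
  rw [Transducer.Survives]
  simp only [Bool.exists_bool, Bool.not_false, Bool.not_true]
  simp [simTransducer, tokenTarget, tokenStep, hb, hb', Target.eval, Slot.eval, Target.tick, h0]

theorem survives_chain_zero_zero (hm : m ≠ 0) (b : Bool) (bits : List Bool) :
    ¬ (simTransducer M ins D w i).Survives (Sum.inr (0, 0, Role.chain)) (b :: bits) := by
  have h0 : (0 : Fin (m + 1)) ≠ Fin.last m := by simpa [Fin.ext_iff] using hm.symm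
  rw [survives_token (by simp [h0]) (t := Sum.inl 0) (by simp [tokenStep, h0]) (Or.inl rfl)]
  exact not_survives_dead bits

theorem survives_chain_inner {k : Fin (D + 1)} {u : Fin (m + 1)} (hu : u ≠ Fin.last m)
    (h0 : u ≠ 0) (b : Bool) (bits : List Bool) :
    (simTransducer M ins D w i).Survives (Sum.inr (k, u, Role.chain)) (b :: bits) ↔
      (simTransducer M ins D w i).Survives (Sum.inr (k, u - 1, Role.chain)) bits := by
  have h1 : u - 1 ≠ Fin.last m := by
    intro h
    apply h0
    rw [sub_eq_iff_eq_add] at h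
    simpa using h
  rw [survives_token (by simp [hu]) (t := Target.tick u Role.chain)
    (by simp [tokenStep, hu, h0])] <;> rw [eval_tick] <;> simp [tickSlot, h0, OrderIrrelevant, h1]

theorem survives_choice_imp (hm : m ≠ 0) {k : Fin (D + 1)} :
    ∀ bits, (simTransducer M ins D w i).Survives (Sum.inr (k, Fin.last m, Role.choice)) bits →
      (simTransducer M ins D w i).Survives (Sum.inr (k, Fin.last m, Role.chain)) bits
  | [], _ => rfl
  | b :: bits, h => (survives_chain_last hm b bits).2 (Or.inr ((survives_choice hm b bits).1 h))

/-- The chain may also enter a slot in the middle of a round and decline to become the token of the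
new cell right away; this gives it no further options. -/
theorem survives_chain_next (hm : m ≠ 0) {k : Fin (D + 1)} (hk : k ≠ 0) (b : Bool)
    (bits : List Bool) :
    (simTransducer M ins D w i).Survives (Sum.inr (k, 0, Role.chain)) (b :: bits) ↔
      (simTransducer M ins D w i).Survives (Sum.inr (k - 1, Fin.last m, Role.chain)) bits := by
  have h0 : (0 : Fin (m + 1)) ≠ Fin.last m := by simpa [Fin.ext_iff] using hm.symm
  have hb : ∀ b, bitOf (roundLetter b true) = none := by decide
  have hb' : ∀ b, bitOf (roundLetter b false) = some b := by decide
  have h1 : (0 : Fin (m + 1)) - 1 = Fin.last m := by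
    rw [sub_eq_iff_eq_add]; simp
  have := survives_choice_imp (M := M) (ins := ins) (w := w) (i := i) hm (k := k - 1) bits
  rw [Transducer.Survives]
  simp only [Bool.exists_bool, Bool.not_false, Bool.not_true]
  simp [simTransducer, tokenTarget, tokenStep, hb, hb', Target.eval, Slot.eval, Target.tick, h0,
    hk, h1]
  simpa [simTransducer, tokenTarget, tokenStep, hb, hb', Target.eval, Slot.eval, Target.tick, h0,
    hk, h1] using this

end

/-! ### Startup: the first cycle without fired instructions -/

/-- A family of states that counts down on the bit `false` and leaves for `X` at zero. -/
theorem countdown {m : ℕ} {F : Fin (m + 1) → List Bool → Prop} {X : List Bool → Prop} {V : ℕ}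
    (h1 : ∀ u, u ≠ 0 → u.val ≤ V → ∀ bits, F u (false :: bits) ↔ F (u - 1) bits)
    (h0 : ∀ bits, F 0 (false :: bits) ↔ X bits) :
    ∀ v, v ≤ V → ∀ (hv : v < m + 1) rest,
      F ⟨v, hv⟩ (List.replicate (v + 1) false ++ rest) ↔ X rest
  | 0, _, _, rest => h0 rest
  | v + 1, hV, hv, rest => by
    have : (⟨v + 1, hv⟩ : Fin (m + 1)) - 1 = ⟨v, by omega⟩ := by
      rw [sub_eq_iff_eq_add]
      ext
      simp [Fin.val_add, Nat.mod_eq_of_lt hv, Nat.mod_eq_of_lt (show 1 < m + 1 by omega)]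
    rw [List.replicate_succ, List.cons_append, h1 _ (by simp [Fin.ext_iff]) hV, this]
    exact countdown h1 h0 v (by omega) _ rest

section

variable {α Q G : Type} {D m : ℕ} {M : TuringMachine α Q G}
  {ins : Fin (m + 1) ≃ Option (Q × G × Bool)} {w : ℕ → G × Bool} {i : Fin 6}

theorem zero_sub_one_eq_last {n : ℕ} : (0 : Fin (n + 1)) - 1 = Fin.last n := by
  rw [sub_eq_iff_eq_add]; simp

theorem survives_cell_slot {k : Fin (D + 1)} {x : G × Bool} {v : ℕ} (hv : v < m + 1)
    (rest : List Bool) :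
    (simTransducer M ins D w i).Survives (Sum.inr (k, ⟨v, hv⟩, Role.cell x))
        (List.replicate (v + 1) false ++ rest) ↔
      (simTransducer M ins D w i).Survives (Sum.inr (k - 1, Fin.last m, Role.cell x)) rest := by
  refine countdown (V := v) (F := fun u bits =>
      (simTransducer M ins D w i).Survives (Sum.inr (k, u, Role.cell x)) bits)
    (X := (simTransducer M ins D w i).Survives (Sum.inr (k - 1, Fin.last m, Role.cell x)))
    (fun u hu _ bits => ?_) (fun bits => ?_) v le_rfl hv rest
  · rw [survives_cell_false, tickSlot, if_neg hu]
  · rw [survives_cell_false, tickSlot, if_pos rfl, zero_sub_one_eq_last]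

theorem survives_cell_cycles {x : G × Bool} (c : ℕ) :
    ∀ (j : Fin (D + 1)) (_ : c ≤ j.val) (rest : List Bool),
      (simTransducer M ins D w i).Survives (Sum.inr (j, Fin.last m, Role.cell x))
        (List.replicate (c * (m + 1)) false ++ rest) ↔
      (simTransducer M ins D w i).Survives
        (Sum.inr (⟨j - c, by omega⟩, Fin.last m, Role.cell x)) rest := by
  induction c with
  | zero => intro j _ rest; simp
  | succ c ih =>
    intro j hj rest
    rw [Nat.succ_mul, Nat.add_comm (c * (m + 1)), List.replicate_add, List.append_assoc]
    have hj0 : j ≠ 0 := by rintro rfl; simp at hj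
    have hj1 : (j - 1).val = j.val - 1 := by rw [Fin.val_sub_one_of_ne_zero hj0]
    have := survives_cell_slot (M := M) (ins := ins) (w := w) (i := i) (k := j) (x := x)
      (Nat.lt_succ_self m) (List.replicate (c * (m + 1)) false ++ rest)
    refine this.trans ?_
    rw [ih (j - 1) (by omega) rest]
    have : (⟨(j - 1).val - c, by omega⟩ : Fin (D + 1)) = ⟨j.val - (c + 1), by omega⟩ := by
      ext; simp only; omega
    rw [this]

/-- During a startup without fired instructions the chain can become the token of any of the
cells it meets. -/
theorem survives_chain_startup (hm : m ≠ 0) :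
    ∀ (k : ℕ) (hk : k < D + 1) (rest : List Bool),
      (simTransducer M ins D w i).Survives (Sum.inr (⟨k, hk⟩, Fin.last m, Role.chain))
        (List.replicate ((k + 1) * (m + 1)) false ++ rest) ↔
      ∃ j : Fin (D + 1), D ≤ j + k ∧ (simTransducer M ins D w i).Survives
        (Sum.inr (j, Fin.last m, Role.cell (w j))) rest := by
  intro k
  obtain ⟨v, rfl⟩ : ∃ v, m = v + 1 := ⟨m - 1, by omega⟩
  have hlast : Fin.last (v + 1) - 1 = ⟨v, by omega⟩ := by
    ext; rw [Fin.val_sub_one_of_ne_zero (by simp [Fin.ext_iff])]; simp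
  induction k with
  | zero =>
    intro hk rest
    have e : (0 + 1) * (v + 1 + 1) = (v + 1) + 1 := by ring
    rw [e, List.replicate_succ, List.cons_append, survives_chain_last hm, hlast,
      survives_cell_slot (by omega) rest]
    have := countdown (V := v) (F := fun u bits =>
        (simTransducer M ins D w i).Survives (Sum.inr (⟨0, hk⟩, u, Role.chain)) bits)
      (X := fun _ => False) (fun u hu hV bits => survives_chain_inner (by
        rintro rfl; simp at hV) hu false bits)
      (fun bits => by simpa using survives_chain_zero_zero hm false bits) v le_rfl (by omega) rest
    rw [this, or_false, zero_sub_one_eq_last]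
    constructor
    · intro h
      exact ⟨Fin.last D, by simp, by simpa using h⟩
    · rintro ⟨j, hj, h⟩
      obtain rfl : j = Fin.last D := by ext; simp; omega
      simpa using h
  | succ k ih =>
    intro hk rest
    have e : (k + 1 + 1) * (v + 1 + 1) = ((v + 1) + (k + 1) * (v + 1 + 1)) + 1 := by ring
    rw [e, List.replicate_succ, List.cons_append, survives_chain_last hm, hlast,
      List.replicate_add, List.append_assoc, survives_cell_slot (by omega)]
    have h0 : (⟨k + 1, hk⟩ : Fin (D + 1)) ≠ 0 := by simp [Fin.ext_iff]
    have h1 : (⟨k + 1, hk⟩ : Fin (D + 1)) - 1 = ⟨k, by omega⟩ := by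
      ext; rw [Fin.val_sub_one_of_ne_zero h0]; simp
    have := countdown (V := v) (F := fun u bits =>
        (simTransducer M ins D w i).Survives (Sum.inr (⟨k + 1, hk⟩, u, Role.chain)) bits)
      (X := (simTransducer M ins D w i).Survives
        (Sum.inr (⟨k + 1, hk⟩ - 1, Fin.last (v + 1), Role.chain)))
      (fun u hu hV bits => survives_chain_inner (by rintro rfl; simp at hV) hu false bits)
      (fun bits => survives_chain_next hm h0 false bits) v le_rfl (by omega)
      (List.replicate ((k + 1) * (v + 1 + 1)) false ++ rest)
    rw [this, h1, ih (by omega) rest, zero_sub_one_eq_last,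
      survives_cell_cycles (k + 1) (Fin.last D) (by simp; omega)]
    constructor
    · rintro (h | ⟨j, hj, h⟩)
      · exact ⟨⟨D - (k + 1), by omega⟩, by simp; omega, h⟩
      · exact ⟨j, by omega, h⟩
    · rintro ⟨j, hj, h⟩
      by_cases hjk : D ≤ j + k
      · exact Or.inr ⟨j, hjk, h⟩
      · left
        have : j = ⟨D - (k + 1), by omega⟩ := by ext; simp only; omega
        rw [this] at h
        exact h

/-- After a startup without fired instructions the head is at the cell `0` in the start state. -/
theorem survives_pre_startup :
    ∀ (c : ℕ) (k : Fin (D + 1)) (u : Fin (m + 1)), c = k * (m + 1) + u → ∀ rest : List Bool,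
      (simTransducer M ins D w i).Survives (Sum.inr (k, u, Role.pre))
        (List.replicate (c + 1) false ++ rest) ↔
      (simTransducer M ins D w i).Survives (Sum.inr (0, Fin.last m, Role.head M.start)) rest := by
  intro c
  induction c with
  | zero =>
    intro k u h rest
    obtain rfl : u = 0 := Fin.ext (show u.val = 0 by omega)
    obtain rfl : k = 0 := by
      ext
      have : k.val * (m + 1) = 0 := by omega
      simpa using this
    exact survives_pre_zero rest
  | succ c ih =>
    intro k u h rest
    have hku : ¬ (k = 0 ∧ u = 0) := by
      rintro ⟨rfl, rfl⟩; simp at h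
    rw [List.replicate_succ, List.cons_append, survives_pre_false hku]
    apply ih
    by_cases hu : u = 0
    · subst hu
      have hk : k ≠ 0 := fun hk => hku ⟨hk, rfl⟩
      have hk' : k.val ≠ 0 := fun h => hk (Fin.ext h)
      rw [tickSlot, if_pos rfl, Fin.val_sub_one_of_ne_zero hk, zero_sub_one_eq_last, Fin.val_last]
      obtain ⟨l, hl⟩ := Nat.exists_eq_succ_of_ne_zero hk'
      simp only [hl, Fin.val_zero, Nat.succ_mul, Nat.succ_sub_one] at h ⊢
      omega
    · have hu' : u.val ≠ 0 := fun h => hu (Fin.ext h)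
      rw [tickSlot, if_neg hu, Fin.val_sub_one_of_ne_zero hu]
      omega

/-- An instruction that is fired during startup is caught by the token that becomes the head. -/
theorem startup_of_not_survives_pre :
    ∀ (bits : List Bool) (c : ℕ) (k : Fin (D + 1)) (u : Fin (m + 1)), c = k * (m + 1) + u →
      ¬ (simTransducer M ins D w i).Survives (Sum.inr (k, u, Role.pre)) bits →
      ∃ rest, bits = List.replicate (c + 1) false ++ rest := by
  intro bits
  induction bits with
  | nil => exact fun _ _ _ _ h => absurd rfl h
  | cons b bits ih =>
    intro c k u hc h
    cases b with
    | true => exact absurd (survives_pre_true bits) h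
    | false =>
      by_cases hku : k = 0 ∧ u = 0
      · obtain ⟨rfl, rfl⟩ := hku
        obtain rfl : c = 0 := by simpa using hc
        exact ⟨bits, rfl⟩
      · rw [survives_pre_false hku] at h
        have hc0 : c = tickSlot k u * (m + 1) + (u - 1 : Fin (m + 1)) + 1 := by
          by_cases hu : u = 0
          · subst hu
            have hk : k ≠ 0 := fun hk => hku ⟨hk, rfl⟩
            have hk' : k.val ≠ 0 := fun h => hk (Fin.ext h)
            rw [tickSlot, if_pos rfl, Fin.val_sub_one_of_ne_zero hk, zero_sub_one_eq_last,
              Fin.val_last]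
            obtain ⟨l, hl⟩ := Nat.exists_eq_succ_of_ne_zero hk'
            simp only [hl, Fin.val_zero, Nat.succ_mul, Nat.succ_sub_one] at hc ⊢
            omega
          · have hu' : u.val ≠ 0 := fun h => hu (Fin.ext h)
            rw [tickSlot, if_neg hu, Fin.val_sub_one_of_ne_zero hu]
            omega
        obtain ⟨rest, rfl⟩ := ih _ _ _ rfl h
        refine ⟨rest, ?_⟩
        rw [hc0, ← List.cons_append, ← List.replicate_succ]

/-! ### The tokens of a configuration -/

/-- The token of the cell `j` of the configuration `c`, when the clock of the machine is at
slot `g` and instruction `u`. -/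
noncomputable def cellToken (c : TuringMachine.Cfg Q G) (g : Fin (D + 1)) (u : Fin (m + 1))
    (j : Fin (D + 1)) : SimState D m Q G :=
  Sum.inr (j - g, u, Role.cell (c.tape j, decide (j = 0)))

/-- The token of the head of a configuration, when the head is at the cell `h`. -/
def headToken (c : TuringMachine.Cfg Q G) (g : Fin (D + 1)) (u : Fin (m + 1))
    (h : Fin (D + 1)) : SimState D m Q G :=
  Sum.inr (h - g, u, Role.head c.state)

/-- The slot of the global clock after one clock step. -/
def nextSlot (g : Fin (D + 1)) (u : Fin (m + 1)) : Fin (D + 1) := if u = 0 then g + 1 else g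

theorem tickSlot_sub (j g : Fin (D + 1)) (u : Fin (m + 1)) :
    tickSlot (j - g) u = j - nextSlot g u := by
  unfold tickSlot nextSlot
  split_ifs
  · abel
  · rfl

theorem survives_cellToken_false {c : TuringMachine.Cfg Q G} {g : Fin (D + 1)}
    {u : Fin (m + 1)} {j : Fin (D + 1)} {bits : List Bool} :
    (simTransducer M ins D w i).Survives (cellToken c g u j) (false :: bits) ↔
      (simTransducer M ins D w i).Survives (cellToken c (nextSlot g u) (u - 1) j) bits := by
  rw [cellToken, survives_cell_false, tickSlot_sub, cellToken]

theorem survives_headToken_false {c : TuringMachine.Cfg Q G} {g : Fin (D + 1)}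
    {u : Fin (m + 1)} {h : Fin (D + 1)} {bits : List Bool} :
    (simTransducer M ins D w i).Survives (headToken c g u h) (false :: bits) ↔
      (simTransducer M ins D w i).Survives (headToken c (nextSlot g u) (u - 1) h) bits := by
  rw [headToken, survives_head_false, tickSlot_sub, headToken]

theorem step_of_not_halted {c : TuringMachine.Cfg Q G} (ha : c.state ≠ M.accept)
    (hr : c.state ≠ M.reject) :
    M.step c = { state := (M.trans c.state (c.tape c.head)).1
                 head := TuringMachine.moveHead c.head (M.trans c.state (c.tape c.head)).2.2
                 tape := Function.update c.tape c.head (M.trans c.state (c.tape c.head)).2.1 } := by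
  rw [TuringMachine.step, if_neg (by tauto)]

theorem step_of_halted {c : TuringMachine.Cfg Q G}
    (h : c.state = M.accept ∨ c.state = M.reject) : M.step c = c := by
  rw [TuringMachine.step, if_pos h]

theorem iterate_step_of_halted {c : TuringMachine.Cfg Q G}
    (h : c.state = M.accept ∨ c.state = M.reject) (t : ℕ) : M.step^[t] c = c :=
  Function.iterate_fixed (step_of_halted h) t

/-- Firing the instruction for the actual state and symbol in the slot of the head takes the
tokens of a configuration to those of its successor. -/
theorem survives_fire {c : TuringMachine.Cfg Q G} {u : Fin (m + 1)} {h h' : Fin (D + 1)}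
    (hh : h.val = c.head) (hh' : h'.val = (M.step c).head)
    (hu : ins u = some (c.state, c.tape c.head, decide (h = 0)))
    (ha : c.state ≠ M.accept) (hr : c.state ≠ M.reject) (bits : List Bool) :
    (∀ j, (simTransducer M ins D w i).Survives (cellToken c h u j) (true :: bits) ↔
      (simTransducer M ins D w i).Survives (cellToken (M.step c) (nextSlot h u) (u - 1) j) bits) ∧
    (u ≠ 0 → ((simTransducer M ins D w i).Survives (headToken c h u h) (true :: bits) ↔
      (simTransducer M ins D w i).Survives (headToken (M.step c) (nextSlot h u) (u - 1) h')
        bits)) := by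
  rw [step_of_not_halted ha hr] at hh' ⊢
  constructor
  · intro j
    by_cases hj : j = h
    · subst hj
      rw [cellToken, hh, sub_self, survives_cell_match hu hr, cellToken, ← tickSlot_sub, sub_self]
      simp [hh]
    · rw [cellToken, survives_cell_other hu hr (sub_ne_zero.2 hj), tickSlot_sub, cellToken]
      have : j.val ≠ c.head := fun e => hj (Fin.ext (e.trans hh.symm))
      simp [this]
  · intro hu0
    rw [headToken, sub_self, survives_head_match hu ha hr, headToken, nextSlot, if_neg hu0]
    simp only at hh' ⊢
    have key : (match (M.trans c.state (c.tape c.head)).2.2 with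
            | Turing.Dir.right => (1 : Fin (D + 1))
            | Turing.Dir.left => if decide (h = 0) = true then 0 else -1) = h' - h := by
      rw [eq_sub_iff_add_eq]
      rcases hd : (M.trans c.state (c.tape c.head)).2.2 with _ | _ <;>
        rw [hd] at hh' <;> simp only [TuringMachine.moveHead] at hh'
      · by_cases h0 : h = 0
        · subst h0
          simp at hh
          ext
          simp [hh', ← hh]
        · simp only [h0, decide_false, Bool.false_eq_true, if_false]
          rw [neg_add_eq_sub]
          ext
          rw [Fin.val_sub_one_of_ne_zero h0, hh', hh]
      · ext
        have := h'.isLt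
        change ((1 : Fin (D + 1)) + h).val = _
        rw [add_comm (1 : Fin (D + 1)), Fin.val_add_one_of_lt' (by omega), hh', hh]
    rw [← key]

/-- If the machine does not reject, then at least one token survives. -/
theorem exists_token_survives (h0 : ins 0 = none) (bits : List Bool) :
    ∀ (c : TuringMachine.Cfg Q G) (g : Fin (D + 1)) (u : Fin (m + 1)) (h : Fin (D + 1)),
      h.val = c.head → (∀ t, (M.step^[t] c).state ≠ M.reject) →
      (∀ t, (M.step^[t] c).head < D + 1) →
      (∃ j, (simTransducer M ins D w i).Survives (cellToken c g u j) bits) ∨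
        (simTransducer M ins D w i).Survives (headToken c g u h) bits := by
  induction bits with
  | nil => exact fun _ _ _ _ _ _ _ => Or.inr rfl
  | cons b bits ih =>
    intro c g u h hh hr hD
    cases b with
    | false =>
      simp only [survives_cellToken_false, survives_headToken_false]
      exact ih c _ _ h hh hr hD
    | true =>
      have hrej : c.state ≠ M.reject := hr 0
      by_cases hhead : ∃ y, ins u = some (c.state, y) ∧ h = g ∧ c.state ≠ M.accept
      · obtain ⟨y, hu, rfl, ha⟩ := hhead
        by_cases hy : y = (c.tape c.head, decide (h = 0))
        · subst hy
          have hlt : (M.step c).head < D + 1 := hD 1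
          have hu0 : u ≠ 0 := by rintro rfl; rw [h0] at hu; cases hu
          obtain ⟨h₁, h₂⟩ := survives_fire (i := i) (w := w) (h' := ⟨_, hlt⟩) hh rfl hu ha hrej bits
          simp only [h₁, h₂ hu0]
          exact ih _ _ _ _ rfl (fun t => hr (t + 1)) (fun t => hD (t + 1))
        · refine Or.inl ⟨h, ?_⟩
          rw [cellToken, sub_self, hh]
          exact survives_cell_mismatch hu hrej (Ne.symm hy) bits
      · refine Or.inr (survives_head_mismatch (fun y hu hk => ?_) bits)
        by_contra ha
        exact hhead ⟨y, hu, sub_eq_zero.1 hk, ha⟩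

/-- All tokens of a configuration die on some continuation. -/
def Killable (M : TuringMachine α Q G) (ins : Fin (m + 1) ≃ Option (Q × G × Bool))
    (w : ℕ → G × Bool) (i : Fin 6) (c : TuringMachine.Cfg Q G) (g : Fin (D + 1))
    (u : Fin (m + 1)) (h : Fin (D + 1)) : Prop :=
  ∃ bits, (∀ j, ¬ (simTransducer M ins D w i).Survives (cellToken c g u j) bits) ∧
    ¬ (simTransducer M ins D w i).Survives (headToken c g u h) bits

theorem Killable.of_next {c : TuringMachine.Cfg Q G} {g : Fin (D + 1)} {u : Fin (m + 1)}
    {h : Fin (D + 1)} (hk : Killable M ins w i c (nextSlot g u) (u - 1) h) :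
    Killable M ins w i c g u h := by
  obtain ⟨bits, h₁, h₂⟩ := hk
  exact ⟨false :: bits, fun j => by rw [survives_cellToken_false]; exact h₁ j,
    by rw [survives_headToken_false]; exact h₂⟩

theorem Killable.of_le {c : TuringMachine.Cfg Q G} {g : Fin (D + 1)} {u : Fin (m + 1)}
    {h : Fin (D + 1)} (hk : Killable M ins w i c g u h) :
    ∀ (d v : ℕ) (hv : v < m + 1), v = u + d → Killable M ins w i c g ⟨v, hv⟩ h
  | 0, v, hv, e => by
    obtain rfl : u = ⟨v, hv⟩ := Fin.ext e.symm
    exact hk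
  | d + 1, v, hv, e => by
    have h0 : (⟨v, hv⟩ : Fin (m + 1)) ≠ 0 := by
      intro h; rw [Fin.ext_iff] at h; simp at h; omega
    have h1 : (⟨v, hv⟩ : Fin (m + 1)) - 1 = ⟨v - 1, by omega⟩ := by
      ext; rw [Fin.val_sub_one_of_ne_zero h0]
    apply Killable.of_next
    rw [nextSlot, if_neg h0, h1]
    exact Killable.of_le hk d (v - 1) _ (by omega)

/-- Waiting lets the clock run through all its values, so the clock does not matter. -/
theorem Killable.clock {c : TuringMachine.Cfg Q G} {g : Fin (D + 1)} {u : Fin (m + 1)}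
    {h : Fin (D + 1)} (hk : Killable M ins w i c g u h) (g' : Fin (D + 1)) (u' : Fin (m + 1)) :
    Killable M ins w i c g' u' h := by
  have hstep : ∀ (g : Fin (D + 1)) (u : Fin (m + 1)), Killable M ins w i c g u h →
      ∀ u', Killable M ins w i c (g - 1) u' h := by
    intro g u hk u'
    have hlast : Killable M ins w i c g (Fin.last m) h :=
      hk.of_le (m - u) m (by omega) (by omega)
    have hzero : Killable M ins w i c (g - 1) (0 : Fin (m + 1)) h := by
      apply Killable.of_next
      rwa [nextSlot, if_pos rfl, sub_add_cancel, zero_sub_one_eq_last]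
    exact hzero.of_le u' u' (by omega) (by simp)
  -- Going back slot by slot reaches every slot, as the slots are cyclic.
  have hall : ∀ (n : ℕ) (g' : Fin (D + 1)), (g - 1 - g').val = n →
      ∀ u', Killable M ins w i c g' u' h := by
    intro n
    induction n with
    | zero =>
      intro g' hn u'
      obtain rfl : g - 1 = g' := sub_eq_zero.1 (Fin.ext hn)
      exact hstep g u hk u'
    | succ n ih =>
      intro g' hn u'
      have hne : g - 1 - g' ≠ 0 := by intro h; rw [h] at hn; simp at hn
      have := hstep (g' + 1) u' (ih (g' + 1) (by
        rw [← sub_sub, Fin.val_sub_one_of_ne_zero hne, hn, Nat.add_sub_cancel]) u') u'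
      rwa [add_sub_cancel_right] at this
  exact hall _ g' rfl u'

/-- If the machine rejects, then the tokens die on the sequence of instructions that it performs
followed by the instruction that claims the rejecting state. -/
theorem killable_of_reject (t : ℕ) :
    ∀ (c : TuringMachine.Cfg Q G) (h : Fin (D + 1)), h.val = c.head →
      (M.step^[t] c).state = M.reject → (∀ t, (M.step^[t] c).head < D + 1) → ins 0 = none →
      ∀ (g : Fin (D + 1)) (u : Fin (m + 1)), Killable M ins w i c g u h := by
  induction t with
  | zero =>
    intro c h hh hr _ _ g u
    obtain ⟨v, hv⟩ := ins.surjective (some (M.reject, c.tape c.head, decide (h = 0)))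
    refine Killable.clock (g := h) (u := v) ⟨[true], fun j => ?_, ?_⟩ g u
    · exact not_survives_cell_reject hv []
    · have hr : c.state = M.reject := hr
      rw [headToken, sub_self, hr]
      exact not_survives_head_reject hv []
  | succ t ih =>
    intro c h hh hr hD h0 g u
    by_cases hrej : c.state = M.reject
    · obtain ⟨v, hv⟩ := ins.surjective (some (M.reject, c.tape c.head, decide (h = 0)))
      refine Killable.clock (g := h) (u := v) ⟨[true], fun j => ?_, ?_⟩ g u
      · exact not_survives_cell_reject hv []
      · rw [headToken, sub_self, hrej]
        exact not_survives_head_reject hv []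
    · have ha : c.state ≠ M.accept := by
        intro ha
        rw [iterate_step_of_halted (Or.inl ha)] at hr
        exact hrej hr
      have hlt : (M.step c).head < D + 1 := hD 1
      obtain ⟨v, hv⟩ := ins.surjective (some (c.state, c.tape c.head, decide (h = 0)))
      have hv0 : v ≠ 0 := by rintro rfl; rw [h0] at hv; cases hv
      obtain ⟨bits, hb₁, hb₂⟩ := ih (M.step c) ⟨_, hlt⟩ rfl hr (fun t => hD (t + 1)) h0
        (nextSlot h v) (v - 1)
      obtain ⟨h₁, h₂⟩ := survives_fire (i := i) (w := w) (h' := ⟨_, hlt⟩) hh rfl hv ha hrej bits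
      exact Killable.clock (g := h) (u := v)
        ⟨true :: bits, fun j => by rw [h₁]; exact hb₁ j, by rw [h₂ hv0]; exact hb₂⟩ g u

/-! ### Round equivalence of the two transducers -/

/-- All bit sequences are survived by the chain or by the token of the head if and only if the
machine does not reject. -/
theorem forall_survives_iff (h0 : ins 0 = none) (x : List α)
    (hw : ∀ j ≤ D, w j = ((M.init x).tape j, decide (j = 0)))
    (hD : ∀ t, (M.run x t).head < D + 1) :
    (∀ bits, (simTransducer M ins D w i).Survives
        (Sum.inr (Fin.last D, Fin.last m, Role.chain)) bits ∨
      (simTransducer M ins D w i).Survives (Sum.inr (Fin.last D, Fin.last m, Role.pre)) bits) ↔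
    ∀ t, (M.run x t).state ≠ M.reject := by
  have hm : m ≠ 0 := by
    rintro rfl
    obtain ⟨v, hv⟩ := ins.surjective (some (M.start, M.blank, true))
    obtain rfl : v = 0 := by ext; omega
    rw [h0] at hv
    cases hv
  have hcell : ∀ j : Fin (D + 1), (Sum.inr (j, Fin.last m, Role.cell (w j)) : SimState D m Q G) =
      cellToken (M.init x) 0 (Fin.last m) j := by
    intro j
    have e : decide (j.val = 0) = decide (j = 0) := decide_eq_decide.2 (by rw [Fin.ext_iff]; rfl)
    rw [cellToken, hw j (by omega), sub_zero, e]
  have hhead : (Sum.inr (0, Fin.last m, Role.head M.start) : SimState D m Q G) =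
      headToken (M.init x) 0 (Fin.last m) 0 := by
    rw [headToken, sub_zero]; rfl
  have hlen : D * (m + 1) + m + 1 = (D + 1) * (m + 1) := by ring
  constructor
  · intro hall t hr
    obtain ⟨bits, h₁, h₂⟩ := killable_of_reject (M := M) (ins := ins) (w := w) (i := i) t (M.init x)
      (0 : Fin (D + 1)) rfl hr hD h0 0 (Fin.last m)
    rcases hall (List.replicate ((D + 1) * (m + 1)) false ++ bits) with h | h
    · obtain ⟨j, -, h⟩ := (survives_chain_startup hm D (by omega) bits).1 h
      rw [hcell] at h
      exact h₁ j h
    · refine h₂ (hhead ▸ (survives_pre_startup _ (Fin.last D) (Fin.last m) rfl bits).1 ?_)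
      rwa [Fin.val_last, Fin.val_last, hlen]
  · intro hr bits
    by_contra hcon
    -- As the token of the head does not survive, the first cycle is free of fired instructions.
    obtain ⟨h₁, h₂⟩ := not_or.1 hcon
    obtain ⟨rest, rfl⟩ := startup_of_not_survives_pre bits _ (Fin.last D) (Fin.last m) rfl h₂
    rw [survives_pre_startup _ (Fin.last D) (Fin.last m) rfl, hhead] at h₂
    rw [Fin.val_last, Fin.val_last, hlen] at h₁
    rcases exists_token_survives (M := M) (w := w) (i := i) h0 rest (M.init x) 0 (Fin.last m)
      (0 : Fin (D + 1)) rfl hr hD with ⟨j, h⟩ | h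
    · exact h₁ ((survives_chain_startup hm D (by omega) rest).2 ⟨j, by omega, by rwa [hcell]⟩)
    · exact h₂ h

theorem outputFrom_sim_start (i' : Fin 6) (p : SimState D m Q G) (v : List Letter) :
    (simTransducer M ins D w i).outputFrom p v = (simTransducer M ins D w i').outputFrom p v := by
  induction v generalizing p with
  | nil => rfl
  | cons l v ih => exact congrArg₂ _ rfl (ih _)

/-- In the first transducer every word of `(ab + cd)*` leads to the sink, so all its outputs are
`false` and the second transducer has to survive. Conversely the first transducer imitates the
second one by exchanging the letters of the first round. -/
theorem roundEquivalent_iff_survives :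
    RoundEquivalent 2 abcdStar (simTransducer M ins D w 2) (simTransducer M ins D w 3) ↔
    ∀ bits, (simTransducer M ins D w 3).Survives
        (Sum.inr (Fin.last D, Fin.last m, Role.chain)) bits ∨
      (simTransducer M ins D w 3).Survives (Sum.inr (Fin.last D, Fin.last m, Role.pre)) bits := by
  have hback : RoundSimulates 2 abcdStar (simTransducer M ins D w 3)
      (simTransducer M ins D w 2) := by
    intro x hx hR
    obtain ⟨bits, rfl⟩ := mem_abcdStar.1 hx
    have hrefl : ∀ {β : Type} [DecidableEq β] (y : List β) (b : ℕ), y.length = 2 * b →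
        RoundEq 2 y y := fun y b h => ⟨b, h, h, fun _ _ => rfl⟩
    cases bits with
    | nil => exact ⟨[], hR, hrefl [] 0 rfl, hrefl [] 0 rfl⟩
    | cons b bits =>
      refine ⟨roundLetter b true :: roundLetter b false :: word bits, ⟨bits.length + 1, ?_⟩, ?_, ?_⟩
      · simp [length_word]; ring
      · rw [word_cons, roundEq_cons_left]
        exact ⟨_, _, _, rfl, parikh_pair_letter.2 ⟨true, rfl, rfl⟩,
          hrefl _ _ (length_word bits)⟩
      · have : (simTransducer M ins D w 3).output (word (b :: bits)) =
            (simTransducer M ins D w 2).output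
              (roundLetter b true :: roundLetter b false :: word bits) := by
          rw [word_cons, Transducer.output, outputFrom_sim_start 2]
          cases b <;> rfl
        rw [this]
        exact hrefl _ (bits.length + 1) (by
          rw [Transducer.output, length_outputFrom]; simp [length_word]; ring)
  have hzero : ∀ bits, ∀ l ∈ (simTransducer M ins D w 2).output (word bits), l = false := by
    have halive : ∀ v, ∀ l ∈ (simTransducer M ins D w 2).outputFrom (Sum.inl 1) v, l = false := by
      intro v
      induction v with
      | nil => intro l hl; cases hl
      | cons l' v ih =>
        intro l hl
        rcases List.mem_cons.1 hl with rfl | hl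
        · rfl
        · exact ih l hl
    intro bits
    cases bits with
    | nil => intro l hl; cases hl
    | cons b bits =>
      intro l hl
      rw [word_cons] at hl
      rcases List.mem_cons.1 hl with rfl | hl
      · cases b <;> rfl
      · exact halive (roundLetter b true :: word bits) l (by cases b <;> exact hl)
  have hforth : RoundSimulates 2 abcdStar (simTransducer M ins D w 2)
      (simTransducer M ins D w 3) ↔
      ∀ bits, (simTransducer M ins D w 3).Survives (Sum.inl 3) bits := by
    constructor
    · intro h bits
      obtain ⟨x', -, hx', hout⟩ := h (word bits) (mem_abcdStar.2 ⟨bits, rfl⟩)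
        ⟨bits.length, length_word bits⟩
      rw [roundEq_of_forall_false (hzero bits)] at hout
      exact (survives_iff _ _ _).2 ⟨rfl, x', hx', hout.2.2⟩
    · intro h x hx hR
      obtain ⟨bits, rfl⟩ := mem_abcdStar.1 hx
      obtain ⟨-, x', hx', hl⟩ := (survives_iff _ _ _).1 (h bits)
      have hlen := roundEq_length hx'
      refine ⟨x', ⟨bits.length, by rw [← hlen, length_word]⟩, hx', ?_⟩
      rw [roundEq_of_forall_false (hzero bits)]
      refine ⟨?_, ?_, hl⟩
      · rw [Transducer.output, length_outputFrom, length_word]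
        exact even_two_mul _
      · rw [Transducer.output, length_outputFrom, Transducer.output, length_outputFrom, hlen]
  have hcons : ∀ b bits, (simTransducer M ins D w 3).Survives (Sum.inl 3) (b :: bits) ↔
      (simTransducer M ins D w 3).Survives (Sum.inr (Fin.last D, Fin.last m, Role.chain)) bits ∨
      (simTransducer M ins D w 3).Survives (Sum.inr (Fin.last D, Fin.last m, Role.pre)) bits := by
    intro b bits
    have e : ∀ s : Role Q G, (Target.eval (0 : Fin (D + 1))
        (Sum.inr (Slot.prev, Fin.last m, s) : Target m Q G)) =
        Sum.inr (Fin.last D, Fin.last m, s) := by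
      intro s
      rw [Target.eval, Slot.eval, zero_sub_one_eq_last]
    rw [Transducer.Survives]
    simp only [Bool.exists_bool, Bool.not_false, Bool.not_true]
    rw [← e Role.chain, ← e Role.pre]
    cases b <;> simp [simTransducer, specialTarget, roundLetter, bitOf, Target.eval]
  rw [RoundEquivalent, hforth]
  constructor
  · exact fun h bits => (hcons true bits).1 (h.1 (true :: bits))
  · refine fun h => ⟨fun bits => ?_, hback⟩
    cases bits with
    | nil => rfl
    | cons b bits => exact (hcons b bits).2 (h bits)

end

/-! ### A structured language for stack machines -/

/-- The counters of the stack programs. -/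
inductive Counter
  | len | cnt | aux | tmp
  deriving DecidableEq

instance : Fintype Counter := ⟨{.len, .cnt, .aux, .tmp}, fun k => by cases k <;> decide⟩

/-- The memory of a stack program over the input alphabet `α`: a flag, a register with a symbol
from `A`, the unread input, two buffers, the output and the counters. -/
@[ext]
structure Memory (α A : Type) where
  flag : Bool
  sym : A
  inp : List α
  buf : Bool → List A
  out : List Bool
  ctr : Counter → ℕ

/-- The elementary operations. -/
inductive Operation (α A : Type)
  /-- increment a counter -/
  | inc (k : Counter)
  /-- decrement a counter; the flag tells whether it was positive -/
  | dec (k : Counter)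
  /-- put a bit in front of the output -/
  | emit (b : Bool)
  /-- read an input letter into the register; the flag tells whether there was one -/
  | read (f : α → A)
  /-- push the register onto a buffer -/
  | push (i : Bool)
  /-- pop a buffer into the register, with a default value for the empty buffer; the flag tells
  whether it was nonempty -/
  | pop (i : Bool) (d : A)
  /-- change the register and clear the flag -/
  | modify (f : A → A)

/-- The effect of an elementary operation. -/
def Operation.apply {α A : Type} : Operation α A → Memory α A → Memory α A
  | inc k, s => { s with ctr := Function.update s.ctr k (s.ctr k + 1) }
  | dec k, s => { s with
      flag := s.ctr k ≠ 0
      ctr := Function.update s.ctr k (s.ctr k - 1) }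
  | emit b, s => { s with out := b :: s.out }
  | read f, s => { s with
      flag := s.inp.head?.isSome
      sym := (s.inp.head?.map f).getD s.sym
      inp := s.inp.tail }
  | push i, s => { s with buf := Function.update s.buf i (s.sym :: s.buf i) }
  | pop i d, s => { s with
      flag := (s.buf i).head?.isSome
      sym := (s.buf i).head?.getD d
      buf := Function.update s.buf i (s.buf i).tail }
  | modify f, s => { s with
      flag := false
      sym := f s.sym }

/-- Structured programs. -/
inductive Program (α A : Type)
  | op (o : Operation α A)
  | seq (c₁ c₂ : Program α A)
  /-- continue with the program selected by the register -/
  | switch (f : A → Program α A)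
  /-- execute `o`; if it sets the flag, execute `c` and start again -/
  | loop (o : Operation α A) (c : Program α A)

/-- `Exec c s s' t`: started in `s`, the program `c` ends in `s'` after `t` steps. -/
inductive Exec {α A : Type} : Program α A → Memory α A → Memory α A → ℕ → Prop
  | op {o s} : Exec (.op o) s (o.apply s) 1
  | seq {c₁ c₂ s s₁ s₂ t₁ t₂} : Exec c₁ s s₁ t₁ → Exec c₂ s₁ s₂ t₂ →
      Exec (.seq c₁ c₂) s s₂ (t₁ + t₂)
  | switch {f s s' t} : Exec (f s.sym) s s' t → Exec (.switch f) s s' (1 + t)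
  | loop_done {o c s} : (o.apply s).flag = false → Exec (.loop o c) s (o.apply s) 1
  | loop_step {o c s s₁ s₂ t₁ t₂} : (o.apply s).flag = true → Exec c (o.apply s) s₁ t₁ →
      Exec (.loop o c) s₁ s₂ t₂ → Exec (.loop o c) s s₂ (1 + (t₁ + t₂))

/-! ### Compilation to `Turing.FinTM2` -/

/-- The stacks of the compiled machine. -/
inductive Stack
  | inp | buf (i : Bool) | out | ctr (k : Counter)
  deriving DecidableEq, Fintype

/-- The stack alphabets; counters are unary. -/
def StackAlphabet (α A : Type) : Stack → Type
  | .inp => α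
  | .buf _ => A
  | .out => Bool
  | .ctr _ => Unit

/-- The stack contents that represent a memory. -/
def Memory.stacks {α A : Type} (s : Memory α A) : ∀ k, List (StackAlphabet α A k)
  | .inp => s.inp
  | .buf i => s.buf i
  | .out => s.out
  | .ctr k => List.replicate (s.ctr k) ()

/-- The statement that performs an operation and continues with `q`. -/
def Operation.stmt {α A Λ : Type} :
    Operation α A → Turing.TM2.Stmt (StackAlphabet α A) Λ (Bool × A) →
      Turing.TM2.Stmt (StackAlphabet α A) Λ (Bool × A)
  | inc k, q => .push (.ctr k) (fun _ => ()) q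
  | dec k, q => .pop (.ctr k) (fun v o => (o.isSome, v.2)) q
  | emit b, q => .push .out (fun _ => b) q
  | read f, q => .pop .inp (fun v o => (o.isSome, (Option.map f o).getD v.2)) q
  | push i, q => .push (.buf i) (fun v => v.2) q
  | pop i d, q => .pop (.buf i) (fun _ o => (o.isSome, Option.getD o d)) q
  | modify f, q => .load (fun v => (false, f v.2)) q

/-- To update one stack is to pass to a memory that differs only there. -/
theorem Memory.update_stacks {α A : Type} {s s' : Memory α A} (k : Stack)
    {l : List (StackAlphabet α A k)} (hk : s'.stacks k = l)
    (h : ∀ j, j ≠ k → s'.stacks j = s.stacks j) : Function.update s.stacks k l = s'.stacks := by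
  subst hk
  funext j
  by_cases hj : j = k
  · subst hj; rw [Function.update_self]
  · rw [Function.update_of_ne hj, h j hj]

theorem Memory.stacks_congr {α A : Type} {s s' : Memory α A} (k : Stack) (hinp : k ≠ .inp →
    s'.inp = s.inp) (hbuf : ∀ i, k ≠ .buf i → s'.buf i = s.buf i) (hout : k ≠ .out →
    s'.out = s.out) (hctr : ∀ i, k ≠ .ctr i → s'.ctr i = s.ctr i) (j : Stack) (hj : j ≠ k) :
    s'.stacks j = s.stacks j := by
  cases j with
  | inp => exact hinp hj.symm
  | buf i => exact hbuf i hj.symm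
  | out => exact hout hj.symm
  | ctr i => exact congrArg (fun n => List.replicate n ()) (hctr i hj.symm)

theorem stepAux_stmt {α A Λ : Type} (o : Operation α A)
    (q : Turing.TM2.Stmt (StackAlphabet α A) Λ (Bool × A)) (s : Memory α A) :
    Turing.TM2.stepAux (o.stmt q) (s.flag, s.sym) s.stacks =
      Turing.TM2.stepAux q ((o.apply s).flag, (o.apply s).sym) (o.apply s).stacks := by
  cases o with
  | inc k =>
    refine congrArg (Turing.TM2.stepAux q _) (Memory.update_stacks _ ?_
      (Memory.stacks_congr _ (fun _ => rfl) (fun _ _ => rfl) (fun _ => rfl) fun i hi => ?_))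
    · change List.replicate (Function.update s.ctr k (s.ctr k + 1) k) () =
        () :: List.replicate (s.ctr k) ()
      rw [Function.update_self, List.replicate_succ]
    · exact Function.update_of_ne (fun e => hi (by rw [e])) _ _
  | dec k =>
    refine congrArg₂ (Turing.TM2.stepAux q) ?_ (Memory.update_stacks _ ?_
      (Memory.stacks_congr _ (fun _ => rfl) (fun _ _ => rfl) (fun _ => rfl) fun i hi => ?_))
    · refine congrArg (fun b => (b, s.sym)) ?_
      change (List.replicate (s.ctr k) ()).head?.isSome = decide (s.ctr k ≠ 0)
      cases s.ctr k <;> simp [List.replicate_succ]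
    · change List.replicate (Function.update s.ctr k (s.ctr k - 1) k) () =
        (List.replicate (s.ctr k) ()).tail
      rw [Function.update_self, List.tail_replicate]
    · exact Function.update_of_ne (fun e => hi (by rw [e])) _ _
  | emit b =>
    exact congrArg (Turing.TM2.stepAux q _) (Memory.update_stacks _ rfl
      (Memory.stacks_congr _ (fun _ => rfl) (fun _ _ => rfl) (fun h => absurd rfl h)
        fun _ _ => rfl))
  | read f =>
    exact congrArg (Turing.TM2.stepAux q _) (Memory.update_stacks _ rfl
      (Memory.stacks_congr _ (fun h => absurd rfl h) (fun _ _ => rfl) (fun _ => rfl)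
        fun _ _ => rfl))
  | push i =>
    exact congrArg (Turing.TM2.stepAux q _) (Memory.update_stacks _ (Function.update_self ..)
      (Memory.stacks_congr _ (fun _ => rfl)
        (fun _ hj => Function.update_of_ne (fun e => hj (by rw [e])) _ _) (fun _ => rfl)
        fun _ _ => rfl))
  | pop i d =>
    exact congrArg (Turing.TM2.stepAux q _) (Memory.update_stacks _ (Function.update_self ..)
      (Memory.stacks_congr _ (fun _ => rfl)
        (fun _ hj => Function.update_of_ne (fun e => hj (by rw [e])) _ _) (fun _ => rfl)
        fun _ _ => rfl))
  | modify f => rfl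

/-- The program points of a program, except its exit. -/
def Program.Label {α A : Type} : Program α A → Type
  | op _ => Unit
  | seq c₁ c₂ => c₁.Label ⊕ c₂.Label
  | switch f => Option (Σ a, (f a).Label)
  | loop _ c => Option c.Label

theorem Program.finite_label {α A : Type} [Finite A] : ∀ c : Program α A, Finite c.Label
  | op _ => inferInstanceAs (Finite Unit)
  | seq c₁ c₂ => by
    have := c₁.finite_label
    have := c₂.finite_label
    exact inferInstanceAs (Finite (c₁.Label ⊕ c₂.Label))
  | switch f => by
    have := fun a => (f a).finite_label
    exact inferInstanceAs (Finite (Option (Σ a, (f a).Label)))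
  | loop _ c => by
    have := c.finite_label
    exact inferInstanceAs (Finite (Option c.Label))

/-- The entry point of a program. -/
def Program.entry {α A : Type} : (c : Program α A) → c.Label
  | op _ => ()
  | seq c₁ _ => Sum.inl c₁.entry
  | switch _ => (none : Option _)
  | loop _ _ => (none : Option _)

/-- The statements at the program points of a program that is part of a machine with labels `Λ`;
on its exit the program jumps to `exit`. -/
def Program.code {α A Λ : Type} : (c : Program α A) → (emb : c.Label → Λ) → (exit : Λ) →
    c.Label → Turing.TM2.Stmt (StackAlphabet α A) Λ (Bool × A)
  | op o, _, exit, _ => o.stmt (.goto fun _ => exit)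
  | seq c₁ c₂, emb, _, Sum.inl l =>
    c₁.code (fun l => emb (Sum.inl l)) (emb (Sum.inr c₂.entry)) l
  | seq _ c₂, emb, exit, Sum.inr l => c₂.code (fun l => emb (Sum.inr l)) exit l
  | switch f, emb, _, none => .goto fun v => emb (some ⟨v.2, (f v.2).entry⟩)
  | switch f, emb, exit, some ⟨a, l⟩ => (f a).code (fun l => emb (some ⟨a, l⟩)) exit l
  | loop o c, emb, exit, none =>
    o.stmt (.branch (fun v => v.1) (.goto fun _ => emb (some c.entry)) (.goto fun _ => exit))
  | loop _ c, emb, _, some l => c.code (fun l => emb (some l)) (emb none) l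

/-- The machine configuration with a given label and memory. -/
def Memory.cfg {α A Λ : Type} (s : Memory α A) (l : Option Λ) :
    Turing.TM2.Cfg (StackAlphabet α A) Λ (Bool × A) :=
  ⟨l, (s.flag, s.sym), s.stacks⟩

/-- The compiled program takes as many steps as the structured one. -/
theorem iterate_step_of_exec {α A Λ : Type}
    {N : Λ → Turing.TM2.Stmt (StackAlphabet α A) Λ (Bool × A)} {c : Program α A}
    {s s' : Memory α A} {t : ℕ} (h : Exec c s s' t) :
    ∀ (emb : c.Label → Λ) (exit : Λ), (∀ l, N (emb l) = c.code emb exit l) →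
      (flip bind (Turing.TM2.step N))^[t] (some (s.cfg (some (emb c.entry)))) =
        some (s'.cfg (some exit)) := by
  induction h with
  | @op o s =>
    intro emb exit hN
    exact (congrArg (fun q => some (Turing.TM2.stepAux q (s.flag, s.sym) s.stacks))
      (hN ())).trans (congrArg some (stepAux_stmt o _ s))
  | @seq c₁ c₂ s s₁ s₂ t₁ t₂ _ _ ih₁ ih₂ =>
    intro emb exit hN
    rw [Nat.add_comm, Function.iterate_add_apply]
    have h₁ := ih₁ (fun l => emb (Sum.inl l)) (emb (Sum.inr c₂.entry)) fun l => hN (Sum.inl l)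
    have h₂ := ih₂ (fun l => emb (Sum.inr l)) exit fun l => hN (Sum.inr l)
    exact (congrArg _ h₁).trans h₂
  | @switch f s s' t _ ih =>
    intro emb exit hN
    rw [Nat.add_comm, Function.iterate_add_apply]
    have h₁ : (flip bind (Turing.TM2.step N))^[1]
        (some (s.cfg (some (emb (Program.switch f).entry)))) =
        some (s.cfg (some (emb (some ⟨s.sym, (f s.sym).entry⟩)))) :=
      congrArg (fun q => some (Turing.TM2.stepAux q (s.flag, s.sym) s.stacks))
        (hN (Program.switch f).entry)
    exact (congrArg _ h₁).trans
      (ih (fun l => emb (some ⟨s.sym, l⟩)) exit fun l => hN (some ⟨s.sym, l⟩))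
  | @loop_done o c s hf =>
    intro emb exit hN
    refine (congrArg (fun q => some (Turing.TM2.stepAux q (s.flag, s.sym) s.stacks))
      (hN (Program.loop o c).entry)).trans (congrArg some ((stepAux_stmt o _ s).trans ?_))
    simp only [Turing.TM2.stepAux, hf, cond_false]
    simp only [Memory.cfg, hf]
  | @loop_step o c s s₁ s₂ t₁ t₂ hf _ _ ih₁ ih₂ =>
    intro emb exit hN
    rw [Nat.add_comm, Function.iterate_add_apply, Nat.add_comm, Function.iterate_add_apply]
    have h₁ : (flip bind (Turing.TM2.step N))^[1]
        (some (s.cfg (some (emb (Program.loop o c).entry)))) =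
        some ((o.apply s).cfg (some (emb (some c.entry)))) := by
      refine (congrArg (fun q => some (Turing.TM2.stepAux q (s.flag, s.sym) s.stacks))
        (hN (Program.loop o c).entry)).trans (congrArg some ((stepAux_stmt o _ s).trans ?_))
      simp only [Turing.TM2.stepAux, hf, cond_true]
      simp only [Memory.cfg, hf]
    have h₂ := ih₁ (fun l => emb (some l)) (emb none) fun l => hN (some l)
    have h₃ := ih₂ emb exit hN
    exact (congrArg _ ((congrArg _ h₁).trans h₂)).trans h₃

/-- The memory with the given input and output and everything else cleared. -/
def Memory.io {α A : Type} (d : A) (x : List α) (y : List Bool) : Memory α A where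
  flag := false
  sym := d
  inp := x
  buf _ := []
  out := y
  ctr _ := 0

open Classical in
/-- The machine of a program. -/
noncomputable def Program.machine {α A : Type} [Finite α] [Finite A] (c : Program α A) (d : A) :
    Turing.FinTM2 :=
  haveI := c.finite_label
  { K := Stack
    k₀ := .inp
    k₁ := .out
    Γ := StackAlphabet α A
    Λ := Option c.Label
    main := some c.entry
    ΛFin := Fintype.ofFinite _
    σ := Bool × A
    initialState := (false, d)
    σFin := Fintype.ofFinite _
    Γk₀Fin := @Fintype.ofFinite α _
    m := fun
      | none => .halt
      | some l => c.code some none l }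

/-- A function that is computed by a program within polynomially many steps, with a cleared memory
at the end, is computable in polynomial time. -/
theorem computable_of_exec {α A : Type} [Finite α] [Finite A] (c : Program α A) (d : A)
    (f : List α → List Bool) (p : Polynomial ℕ)
    (h : ∀ x, ∃ t ≤ p.eval x.length, Exec c (Memory.io d x []) (Memory.io d [] (f x)) t) :
    Nonempty (Turing.TM2ComputableInPolyTime (id : List α → List α) (id : List Bool → List Bool)
      f) := by
  choose t ht hexec using h
  have hin : ∀ x : List α, Turing.initList (c.machine d) x =
      (Memory.io d x []).cfg (some (some c.entry)) := by
    intro x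
    refine congrArg (Turing.TM2.Cfg.mk _ _) (funext fun k => ?_)
    cases k <;> rfl
  have hout : ∀ y : List Bool, Turing.haltList (c.machine d) y = (Memory.io d [] y).cfg none := by
    intro y
    refine congrArg (Turing.TM2.Cfg.mk _ _) (funext fun k => ?_)
    cases k <;> rfl
  refine ⟨{ tm := c.machine d
            inputAlphabet := Equiv.refl α
            outputAlphabet := Equiv.refl Bool
            time := p + 1
            outputsFun := fun x => ?_ }⟩
  -- The additional step is the one that halts at the exit of the program.
  refine ⟨⟨t x + 1, ?_⟩, by simpa using ht x⟩
  have h₁ := iterate_step_of_exec (N := (c.machine d).m) (hexec x) some none fun _ => rfl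
  have e₁ : List.map (Equiv.refl α).invFun (id x) = x := List.map_id x
  have e₂ : List.map (Equiv.refl Bool).invFun (id (f x)) = f x := List.map_id _
  refine Eq.trans ?_ (congrArg some ((hout (f x)).symm.trans
    (congrArg (Turing.haltList (c.machine d)) e₂.symm)))
  refine Eq.trans (congrArg _ (congrArg some ((congrArg _ e₁).trans (hin x)))) ?_
  rw [Function.iterate_succ_apply']
  exact congrArg _ h₁

/-! ### Time bounds for programs -/

section

variable {α A : Type}

/-- Started in `s`, the program `c` ends in `s'` after at most `T` steps. -/
def Runs (c : Program α A) (s s' : Memory α A) (T : ℕ) : Prop := ∃ t ≤ T, Exec c s s' t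

theorem Runs.mono {c : Program α A} {s s' : Memory α A} {T T' : ℕ} (h : Runs c s s' T)
    (hT : T ≤ T') : Runs c s s' T' :=
  let ⟨t, ht, he⟩ := h
  ⟨t, ht.trans hT, he⟩

theorem Runs.op {o : Operation α A} {s s' : Memory α A} (h : o.apply s = s') :
    Runs (.op o) s s' 1 := by
  subst h
  exact ⟨1, le_rfl, .op⟩

theorem Runs.seq {c₁ c₂ : Program α A} {s s₁ s₂ : Memory α A} {T₁ T₂ : ℕ}
    (h₁ : Runs c₁ s s₁ T₁) (h₂ : Runs c₂ s₁ s₂ T₂) : Runs (.seq c₁ c₂) s s₂ (T₁ + T₂) :=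
  let ⟨_, ht₁, he₁⟩ := h₁
  let ⟨_, ht₂, he₂⟩ := h₂
  ⟨_, add_le_add ht₁ ht₂, .seq he₁ he₂⟩

theorem Runs.switch {f : A → Program α A} {s s' : Memory α A} {T : ℕ}
    (h : Runs (f s.sym) s s' T) : Runs (.switch f) s s' (1 + T) :=
  let ⟨_, ht, he⟩ := h
  ⟨_, add_le_add le_rfl ht, .switch he⟩

theorem Runs.loop_done {o : Operation α A} {c : Program α A} {s s' : Memory α A}
    (h : o.apply s = s') (hf : s'.flag = false) : Runs (.loop o c) s s' 1 := by
  subst h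
  exact ⟨1, le_rfl, .loop_done hf⟩

theorem Runs.loop_step {o : Operation α A} {c : Program α A} {s s₀ s₁ s₂ : Memory α A}
    {T₁ T₂ : ℕ} (h : o.apply s = s₀) (hf : s₀.flag = true) (h₁ : Runs c s₀ s₁ T₁)
    (h₂ : Runs (.loop o c) s₁ s₂ T₂) : Runs (.loop o c) s s₂ (1 + (T₁ + T₂)) := by
  subst h
  obtain ⟨_, ht₁, he₁⟩ := h₁
  obtain ⟨_, ht₂, he₂⟩ := h₂
  exact ⟨_, by omega, .loop_step hf he₁ he₂⟩

/-- A memory given by all its components. -/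
def mem (flag : Bool) (sym : A) (inp : List α) (src rev : List A) (out : List Bool)
    (len cnt aux tmp : ℕ) : Memory α A where
  flag := flag
  sym := sym
  inp := inp
  buf i := if i then rev else src
  out := out
  ctr
    | .len => len
    | .cnt => cnt
    | .aux => aux
    | .tmp => tmp

variable {fl : Bool} {y : A} {inp : List α} {src rev : List A} {out : List Bool}
  {len cnt aux tmp : ℕ}

theorem apply_inc_len : (Operation.inc .len).apply (mem fl y inp src rev out len cnt aux tmp) =
    mem fl y inp src rev out (len + 1) cnt aux tmp := by
  ext k <;> try rfl
  cases k <;> rfl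

theorem apply_inc_cnt : (Operation.inc .cnt).apply (mem fl y inp src rev out len cnt aux tmp) =
    mem fl y inp src rev out len (cnt + 1) aux tmp := by
  ext k <;> try rfl
  cases k <;> rfl

theorem apply_inc_aux : (Operation.inc .aux).apply (mem fl y inp src rev out len cnt aux tmp) =
    mem fl y inp src rev out len cnt (aux + 1) tmp := by
  ext k <;> try rfl
  cases k <;> rfl

theorem apply_inc_tmp : (Operation.inc .tmp).apply (mem fl y inp src rev out len cnt aux tmp) =
    mem fl y inp src rev out len cnt aux (tmp + 1) := by
  ext k <;> try rfl
  cases k <;> rfl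

theorem apply_dec_len : (Operation.dec .len).apply (mem fl y inp src rev out len cnt aux tmp) =
    mem (len ≠ 0) y inp src rev out (len - 1) cnt aux tmp := by
  ext k <;> try rfl
  cases k <;> rfl

theorem apply_dec_cnt : (Operation.dec .cnt).apply (mem fl y inp src rev out len cnt aux tmp) =
    mem (cnt ≠ 0) y inp src rev out len (cnt - 1) aux tmp := by
  ext k <;> try rfl
  cases k <;> rfl

theorem apply_dec_aux : (Operation.dec .aux).apply (mem fl y inp src rev out len cnt aux tmp) =
    mem (aux ≠ 0) y inp src rev out len cnt (aux - 1) tmp := by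
  ext k <;> try rfl
  cases k <;> rfl

theorem apply_dec_tmp : (Operation.dec .tmp).apply (mem fl y inp src rev out len cnt aux tmp) =
    mem (tmp ≠ 0) y inp src rev out len cnt aux (tmp - 1) := by
  ext k <;> try rfl
  cases k <;> rfl

theorem apply_push_src :
    (Operation.push false).apply (mem fl y inp src rev out len cnt aux tmp) =
      mem fl y inp (y :: src) rev out len cnt aux tmp := by
  refine Memory.ext rfl rfl rfl (funext fun i => ?_) rfl rfl
  cases i <;> rfl

theorem apply_push_rev :
    (Operation.push true).apply (mem fl y inp src rev out len cnt aux tmp) =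
      mem fl y inp src (y :: rev) out len cnt aux tmp := by
  refine Memory.ext rfl rfl rfl (funext fun i => ?_) rfl rfl
  cases i <;> rfl

theorem apply_pop_src (d : A) :
    (Operation.pop false d).apply (mem fl y inp src rev out len cnt aux tmp) =
      mem src.head?.isSome (src.head?.getD d) inp src.tail rev out len cnt aux tmp := by
  refine Memory.ext rfl rfl rfl (funext fun i => ?_) rfl rfl
  cases i <;> rfl

theorem apply_pop_rev (d : A) :
    (Operation.pop true d).apply (mem fl y inp src rev out len cnt aux tmp) =
      mem rev.head?.isSome (rev.head?.getD d) inp src rev.tail out len cnt aux tmp := by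
  refine Memory.ext rfl rfl rfl (funext fun i => ?_) rfl rfl
  cases i <;> rfl

/-! ### Counting and copying -/

/-- Do nothing, except for clearing the flag. -/
def skip : Program α A := .op (.modify id)

theorem runs_skip : Runs skip (mem fl y inp src rev out len cnt aux tmp)
    (mem false y inp src rev out len cnt aux tmp) 1 :=
  Runs.op rfl

/-- Add the counter `k` to the counter `l` and clear `k`. -/
def moveCounter (k l : Counter) : Program α A := .loop (.dec k) (.op (.inc l))

theorem runs_move_tmp_len : Runs (moveCounter .tmp .len)
    (mem fl y inp src rev out len cnt aux tmp)
    (mem false y inp src rev out (len + tmp) cnt aux 0) (2 * tmp + 1) := by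
  induction tmp generalizing fl len with
  | zero => exact Runs.loop_done apply_dec_tmp rfl
  | succ n ih =>
    rw [show ∀ a, a + (n + 1) = a + 1 + n by omega]
    exact Runs.mono (Runs.loop_step apply_dec_tmp rfl (Runs.op apply_inc_len) ih) (by omega)

theorem runs_move_aux_cnt : Runs (moveCounter .aux .cnt)
    (mem fl y inp src rev out len cnt aux tmp)
    (mem false y inp src rev out len (cnt + aux) 0 tmp) (2 * aux + 1) := by
  induction aux generalizing fl cnt with
  | zero => exact Runs.loop_done apply_dec_aux rfl
  | succ n ih =>
    rw [show ∀ a, a + (n + 1) = a + 1 + n by omega]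
    exact Runs.mono (Runs.loop_step apply_dec_aux rfl (Runs.op apply_inc_cnt) ih) (by omega)

theorem runs_move_tmp_cnt : Runs (moveCounter .tmp .cnt)
    (mem fl y inp src rev out len cnt aux tmp)
    (mem false y inp src rev out len (cnt + tmp) aux 0) (2 * tmp + 1) := by
  induction tmp generalizing fl cnt with
  | zero => exact Runs.loop_done apply_dec_tmp rfl
  | succ n ih =>
    rw [show ∀ a, a + (n + 1) = a + 1 + n by omega]
    exact Runs.mono (Runs.loop_step apply_dec_tmp rfl (Runs.op apply_inc_cnt) ih) (by omega)

theorem runs_clear_len : Runs (.loop (.dec .len) skip)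
    (mem fl y inp src rev out len cnt aux tmp)
    (mem false y inp src rev out 0 cnt aux tmp) (2 * len + 1) := by
  induction len generalizing fl with
  | zero => exact Runs.loop_done apply_dec_len rfl
  | succ n ih => exact (Runs.loop_step apply_dec_len rfl runs_skip ih).mono (by omega)

theorem runs_clear_cnt : Runs (.loop (.dec .cnt) skip)
    (mem fl y inp src rev out len cnt aux tmp)
    (mem false y inp src rev out len 0 aux tmp) (2 * cnt + 1) := by
  induction cnt generalizing fl with
  | zero => exact Runs.loop_done apply_dec_cnt rfl
  | succ n ih => exact (Runs.loop_step apply_dec_cnt rfl runs_skip ih).mono (by omega)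

theorem runs_clear_src (d : A) : Runs (.loop (.pop false d) skip)
    (mem fl y inp src rev out len cnt aux tmp)
    (mem false d inp [] rev out len cnt aux tmp) (2 * src.length + 1) := by
  induction src generalizing fl y with
  | nil => exact Runs.loop_done (apply_pop_src d) rfl
  | cons a src ih =>
    exact (Runs.loop_step (apply_pop_src d) rfl runs_skip ih).mono (by simp; omega)

/-- Pour the second buffer onto the first one. -/
def pour (d : A) : Program α A := .loop (.pop true d) (.op (.push false))

theorem runs_pour (d : A) : Runs (pour d) (mem fl y inp src rev out len cnt aux tmp)
    (mem false d inp (rev.reverse ++ src) [] out len cnt aux tmp) (2 * rev.length + 1) := by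
  induction rev generalizing fl y src with
  | nil => exact Runs.loop_done (apply_pop_rev d) rfl
  | cons a rev ih =>
    rw [List.reverse_cons, List.append_assoc]
    exact Runs.mono (Runs.loop_step (apply_pop_rev d) rfl (Runs.op apply_push_src) ih)
      (by simp; omega)

/-- Read the input into the second buffer, in reverse order, and count its length. -/
def readInput (f : α → A) : Program α A :=
  .loop (.read f) (.seq (.op (.push true)) (.op (.inc .len)))

theorem runs_readInput (f : α → A) : ∃ y', Runs (readInput f)
    (mem fl y inp src rev out len cnt aux tmp)
    (mem false y' [] src ((inp.map f).reverse ++ rev) out (len + inp.length) cnt aux tmp)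
    (3 * inp.length + 1) := by
  induction inp generalizing fl y rev len with
  | nil => exact ⟨y, Runs.loop_done rfl rfl⟩
  | cons a inp ih =>
    obtain ⟨y', h⟩ := ih (fl := true) (y := f a) (rev := f a :: rev) (len := len + 1)
    refine ⟨y', ?_⟩
    rw [List.map_cons, List.reverse_cons, List.append_assoc, List.length_cons,
      show len + (inp.length + 1) = len + 1 + inp.length by omega]
    exact Runs.mono (Runs.loop_step (s₀ := mem true (f a) inp src rev out len cnt aux tmp) rfl rfl
      (Runs.seq (Runs.op apply_push_rev) (Runs.op apply_inc_len)) h) (by omega)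

/-- Multiply the counter `cnt` by the counter `len`. -/
def mulLen : Program α A :=
  .seq
    (.loop (.dec .cnt) (.seq
      (.loop (.dec .len) (.seq (.op (.inc .aux)) (.op (.inc .tmp)))) (moveCounter .tmp .len)))
    (moveCounter .aux .cnt)

theorem runs_mulLen_inner : Runs (.loop (.dec .len) (.seq (.op (.inc .aux)) (.op (.inc .tmp))))
    (mem fl y inp src rev out len cnt aux tmp)
    (mem false y inp src rev out 0 cnt (aux + len) (tmp + len)) (3 * len + 1) := by
  induction len generalizing fl aux tmp with
  | zero => exact Runs.loop_done apply_dec_len rfl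
  | succ n ih =>
    rw [show ∀ a, a + (n + 1) = a + 1 + n by omega, show ∀ a, a + (n + 1) = a + 1 + n by omega]
    exact Runs.mono (Runs.loop_step apply_dec_len rfl
      (Runs.seq (Runs.op apply_inc_aux) (Runs.op apply_inc_tmp)) ih) (by omega)

theorem runs_mulLen_outer : Runs (.loop (.dec .cnt) (.seq
      (.loop (.dec .len) (.seq (.op (.inc .aux)) (.op (.inc .tmp)))) (moveCounter .tmp .len)))
    (mem fl y inp src rev out len cnt aux 0)
    (mem false y inp src rev out len 0 (aux + cnt * len) 0) (cnt * (5 * len + 3) + 1) := by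
  induction cnt generalizing fl aux with
  | zero =>
    rw [Nat.zero_mul, Nat.zero_mul]
    exact Runs.loop_done apply_dec_cnt rfl
  | succ n ih =>
    have h := Runs.seq (runs_mulLen_inner (fl := true) (y := y) (inp := inp) (src := src)
      (rev := rev) (out := out) (len := len) (cnt := n) (aux := aux) (tmp := 0))
      runs_move_tmp_len
    rw [Nat.zero_add, Nat.zero_add] at h
    rw [Nat.succ_mul, Nat.add_comm (n * len), ← Nat.add_assoc]
    refine Runs.mono (Runs.loop_step apply_dec_cnt rfl h ih) ?_
    rw [Nat.succ_mul n]
    omega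

theorem runs_mulLen : Runs mulLen (mem fl y inp src rev out len cnt 0 0)
    (mem false y inp src rev out len (cnt * len) 0 0) (cnt * (7 * len + 3) + 2) := by
  have := Runs.seq (runs_mulLen_outer (fl := fl) (y := y) (inp := inp) (src := src)
    (rev := rev) (out := out) (len := len) (cnt := cnt) (aux := 0)) runs_move_aux_cnt
  rw [Nat.zero_add, Nat.zero_add] at this
  exact this.mono (by nlinarith)

/-- Multiply the counter `cnt` by the `d`-th power of the counter `len`. -/
def mulPow : ℕ → Program α A
  | 0 => skip
  | d + 1 => .seq (mulPow d) mulLen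

theorem runs_mulPow (d : ℕ) (hlen : 0 < len) : Runs (mulPow d)
    (mem fl y inp src rev out len 1 0 0)
    (mem false y inp src rev out len (len ^ d) 0 0) (d * (len ^ d * (7 * len + 3) + 2) + 1) := by
  induction d with
  | zero =>
    rw [Nat.zero_mul]
    exact runs_skip
  | succ d ih =>
    have := Runs.seq ih runs_mulLen
    rw [← Nat.pow_succ] at this
    refine this.mono ?_
    have h : len ^ d * (7 * len + 3) + 2 ≤ len ^ (d + 1) * (7 * len + 3) + 2 := by
      gcongr
      omega
    have := Nat.mul_le_mul_left d h
    rw [Nat.succ_mul d]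
    omega

/-! ### Emitting templates -/

/-- The items of an output template: a bit, or `B` times the counter `cnt` many `true`s. -/
inductive Item
  | lit (b : Bool)
  | rep

/-- The text of a template when the counter has the value `c`. -/
def expand (B c : ℕ) (l : List Item) : List Bool :=
  l.flatMap fun
    | Item.lit b => [b]
    | Item.rep => List.replicate (B * c) true

/-- Put `n` times `true` in front of the output. -/
def emitTrues : ℕ → Program α A
  | 0 => skip
  | n + 1 => .seq (.op (.emit true)) (emitTrues n)

theorem runs_emitTrues (n : ℕ) : Runs (emitTrues n) (mem fl y inp src rev out len cnt aux tmp)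
    (mem false y inp src rev (List.replicate n true ++ out) len cnt aux tmp) (n + 1) := by
  induction n generalizing out with
  | zero => exact runs_skip
  | succ n ih =>
    have := Runs.seq (Runs.op (o := .emit true) (s := mem fl y inp src rev out len cnt aux tmp)
      rfl) (ih (out := true :: out))
    rw [List.replicate_succ', List.append_assoc]
    exact this.mono (by omega)

/-- Put `B` times the counter `cnt` many `true`s in front of the output. -/
def emitRep (B : ℕ) : Program α A :=
  .seq (.loop (.dec .cnt) (.seq (.op (.inc .tmp)) (emitTrues B))) (moveCounter .tmp .cnt)

theorem runs_emitRep_loop (B : ℕ) :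
    Runs (.loop (.dec .cnt) (.seq (.op (.inc .tmp)) (emitTrues B)))
      (mem fl y inp src rev out len cnt aux tmp)
      (mem false y inp src rev (List.replicate (B * cnt) true ++ out) len 0 aux (tmp + cnt))
      (cnt * (B + 3) + 1) := by
  induction cnt generalizing fl out tmp with
  | zero =>
    rw [Nat.zero_mul]
    exact Runs.loop_done apply_dec_cnt rfl
  | succ n ih =>
    rw [Nat.mul_succ, List.replicate_add, List.append_assoc,
      show tmp + (n + 1) = tmp + 1 + n by omega]
    refine Runs.mono (Runs.loop_step apply_dec_cnt rfl
      (Runs.seq (Runs.op apply_inc_tmp) (runs_emitTrues B)) ih) ?_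
    rw [Nat.succ_mul]
    omega

theorem runs_emitRep (B : ℕ) : Runs (emitRep B) (mem fl y inp src rev out len cnt aux 0)
    (mem false y inp src rev (List.replicate (B * cnt) true ++ out) len cnt aux 0)
    (cnt * (B + 5) + 2) := by
  have := Runs.seq (runs_emitRep_loop (fl := fl) (y := y) (inp := inp) (src := src)
    (rev := rev) (out := out) (len := len) (cnt := cnt) (aux := aux) (tmp := 0) B)
    runs_move_tmp_cnt
  rw [Nat.zero_add, Nat.zero_add] at this
  exact this.mono (by nlinarith)

/-- Put the text of a template in front of the output. -/
def emitItems (B : ℕ) : List Item → Program α A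
  | [] => skip
  | Item.lit b :: l => .seq (emitItems B l) (.op (.emit b))
  | Item.rep :: l => .seq (emitItems B l) (emitRep B)

theorem runs_emitItems (B : ℕ) (l : List Item) :
    Runs (emitItems B l) (mem fl y inp src rev out len cnt aux 0)
      (mem false y inp src rev (expand B cnt l ++ out) len cnt aux 0)
      (l.length * (cnt * (B + 5) + 2) + 1) := by
  induction l with
  | nil => rw [List.length_nil, Nat.zero_mul]; exact runs_skip
  | cons i l ih =>
    cases i with
    | lit b =>
      refine (Runs.seq ih (Runs.op (s' := mem false y inp src rev
        (expand B cnt (Item.lit b :: l) ++ out) len cnt aux 0) rfl)).mono ?_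
      rw [List.length_cons, Nat.succ_mul]
      omega
    | rep =>
      have := Runs.seq ih (runs_emitRep B)
      rw [← List.append_assoc] at this
      refine this.mono ?_
      rw [List.length_cons, Nat.succ_mul]
      omega

/-! ### Emitting a table -/

/-- Pop a symbol from the first buffer, push it onto the second one, and emit the template that
it selects. -/
def emitNext (B : ℕ) (d : A) (f : A → List Item) : Program α A :=
  .seq (.op (.pop false d)) (.seq (.op (.push true)) (.switch fun a => emitItems B (f a)))

theorem runs_emitNext (B : ℕ) (d : A) (f : A → List Item) {L : ℕ} (hL : ∀ a, (f a).length ≤ L) :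
    Runs (emitNext B d f) (mem fl y inp src rev out len cnt aux 0)
      (mem false (src.getD 0 d) inp src.tail (src.getD 0 d :: rev)
        (expand B cnt (f (src.getD 0 d)) ++ out) len cnt aux 0)
      (L * (cnt * (B + 5) + 2) + 4) := by
  have e : src.getD 0 d = src.head?.getD d := by cases src <;> rfl
  rw [e]
  have := Runs.seq (Runs.op (apply_pop_src d (fl := fl) (y := y) (inp := inp) (src := src)
    (rev := rev) (out := out) (len := len) (cnt := cnt) (aux := aux) (tmp := 0)))
    (Runs.seq (Runs.op apply_push_rev) (Runs.switch (f := fun a => emitItems B (f a))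
      (runs_emitItems B (f (src.head?.getD d)))))
  refine this.mono ?_
  have := Nat.mul_le_mul_right (cnt * (B + 5) + 2) (hL (src.head?.getD d))
  omega

/-- Emit the blocks of a table from the last one to the first one. Block `0` is given by the
template `g`, the others by `f`. The block `k > 0` is emitted when the counter `cnt` has the value
`k - 1`, and the block `0` when it has its initial value. At the end the counter and, up to default
symbols, the first buffer are restored. -/
def emitTable (B : ℕ) (d : A) (f g : A → List Item) : Program α A :=
  .seq (.loop (.dec .cnt) (.seq (.op (.inc .aux)) (emitNext B d f)))
    (.seq (moveCounter .aux .cnt) (.seq (emitNext B d g) (pour d)))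

/-- The text of the blocks above block `0`. -/
def upperBlocks (B : ℕ) (f : A → List Item) (w : ℕ → A) (D : ℕ) : List Bool :=
  (List.range D).flatMap fun c => expand B c (f (w (D - 1 - c)))

theorem upperBlocks_succ (B : ℕ) (f : A → List Item) (w : ℕ → A) (D : ℕ) :
    upperBlocks B f w (D + 1) =
      upperBlocks B f (fun j => w (j + 1)) D ++ expand B D (f (w 0)) := by
  rw [upperBlocks, List.range_succ, List.flatMap_append, upperBlocks]
  congr 1
  · rw [List.flatMap_def, List.flatMap_def]
    congr 1
    refine List.map_congr_left fun c hc => ?_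
    rw [List.mem_range] at hc
    rw [show D + 1 - 1 - c = D - 1 - c + 1 by omega]
  · simp

/-- Moving the first symbol of one buffer to the other preserves the sequence of symbols, up to
default symbols at its end. -/
theorem getD_reverse_append_move (d : A) (src rev : List A) (j : ℕ) :
    ((src.getD 0 d :: rev).reverse ++ src.tail).getD j d = (rev.reverse ++ src).getD j d := by
  cases src with
  | nil =>
    rw [List.reverse_cons]
    simp only [List.tail_nil, List.append_nil, List.getD_eq_getElem?_getD]
    rw [List.getElem?_append]
    split_ifs with h
    · rfl
    · rw [List.getElem?_eq_none (l := rev.reverse) (by omega)]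
      cases hj : j - rev.reverse.length <;> simp
  | cons a src => simp

theorem runs_emitTable_loop (B : ℕ) (d : A) (f : A → List Item) {L : ℕ}
    (hL : ∀ a, (f a).length ≤ L) {K : ℕ} (hK : cnt ≤ K) : ∃ y' src' rev',
    Runs (.loop (.dec .cnt) (.seq (.op (.inc .aux)) (emitNext B d f)))
      (mem fl y inp src rev out len cnt aux 0)
      (mem false y' inp src' rev' (upperBlocks B f (fun j => src.getD j d) cnt ++ out)
        len 0 (aux + cnt) 0)
      (cnt * (L * (K * (B + 5) + 2) + 6) + 1) ∧
    rev'.length = rev.length + cnt ∧ src' = src.drop cnt ∧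
    ∀ j, (rev'.reverse ++ src').getD j d = (rev.reverse ++ src).getD j d := by
  induction cnt generalizing fl y src rev out aux with
  | zero =>
    refine ⟨y, src, rev, ?_, rfl, rfl, fun _ => rfl⟩
    rw [Nat.zero_mul]
    exact Runs.loop_done apply_dec_cnt rfl
  | succ n ih =>
    obtain ⟨y', src', rev', h, h₁, h₂, h₃⟩ := ih (fl := false) (y := src.getD 0 d)
      (src := src.tail) (rev := src.getD 0 d :: rev)
      (out := expand B n (f (src.getD 0 d)) ++ out) (aux := aux + 1) (by omega)
    refine ⟨y', src', rev', ?_, ?_, ?_, ?_⟩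
    · rw [upperBlocks_succ, List.append_assoc, show aux + (n + 1) = aux + 1 + n by omega]
      have e : (fun j => src.tail.getD j d) = fun j => src.getD (j + 1) d := by
        funext j; cases src <;> simp
      rw [e] at h
      refine Runs.mono (Runs.loop_step apply_dec_cnt rfl
        (Runs.seq (Runs.op apply_inc_aux) (runs_emitNext B d f hL)) h) ?_
      have : L * (n * (B + 5) + 2) ≤ L * (K * (B + 5) + 2) := by gcongr; omega
      rw [Nat.succ_mul]
      simp only [Nat.add_sub_cancel]
      omega
    · rw [h₁, List.length_cons]; omega
    · rw [h₂, List.drop_tail]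
    · intro j
      rw [h₃, getD_reverse_append_move]

theorem runs_emitTable (B : ℕ) (d : A) (f g : A → List Item) {L : ℕ}
    (hf : ∀ a, (f a).length ≤ L) (hg : ∀ a, (g a).length ≤ L) : ∃ src',
    Runs (emitTable B d f g) (mem fl y inp src [] out len cnt 0 0)
      (mem false d inp src' [] (expand B cnt (g (src.getD cnt d)) ++
        (upperBlocks B f (fun j => src.getD j d) cnt ++ out)) len cnt 0 0)
      ((cnt + 1) * (L * (cnt * (B + 5) + 2) + 10) + 4) ∧
    src'.length ≤ src.length + cnt + 1 ∧ ∀ j, src'.getD j d = src.getD j d := by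
  obtain ⟨y', src', rev', h, h₁, h₂, h₃⟩ := runs_emitTable_loop (fl := fl) (y := y)
    (inp := inp) (src := src) (rev := []) (out := out) (len := len) (aux := 0) B d f hf
    (le_refl cnt)
  refine ⟨(src'.getD 0 d :: rev').reverse ++ src'.tail, ?_, ?_, fun j => ?_⟩
  · have hm := runs_move_aux_cnt (fl := false) (y := y') (inp := inp) (src := src') (rev := rev')
      (out := upperBlocks B f (fun j => src.getD j d) cnt ++ out) (len := len) (cnt := 0)
      (aux := 0 + cnt) (tmp := 0)
    rw [Nat.zero_add, Nat.zero_add] at hm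
    rw [Nat.zero_add] at h
    have := Runs.seq h (Runs.seq hm (Runs.seq (runs_emitNext B d g hg) (runs_pour d)))
    have e : src'.getD 0 d = src.getD cnt d := by
      rw [h₂]
      simp [List.getD_eq_getElem?_getD]
    rw [e] at this ⊢
    refine this.mono ?_
    rw [List.length_cons, h₁, List.length_nil, Nat.succ_mul cnt]
    have : cnt * (L * (cnt * (B + 5) + 2) + 10) =
        cnt * (L * (cnt * (B + 5) + 2) + 6) + 4 * cnt := by ring
    omega
  · simp only [List.length_append, List.length_reverse, List.length_cons, List.length_tail, h₁, h₂,
      List.length_nil, List.length_drop]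
    omega
  · rw [getD_reverse_append_move, h₃]
    rfl

/-! ### The whole program -/

/-- Prepare the buffer: read the input, with `mk` applied to its first symbol, and set the counter
`cnt` to `(n + 2) ^ e`, where `n` is the length of the input. -/
def prepare (f : α → A) (d : A) (mk : A → A) (e : ℕ) : Program α A :=
  .seq (readInput f) (.seq (.op (.inc .len)) (.seq (.op (.inc .len)) (.seq (pour d)
    (.seq (.op (.pop false d)) (.seq (.op (.modify mk)) (.seq (.op (.push false))
      (.seq (.op (.inc .cnt)) (.seq (mulPow e) (.loop (.dec .len) skip)))))))))

/-- The input as stored by `prepare`. -/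
def markFirst (d : A) (mk : A → A) (l : List A) : List A := mk (l.head?.getD d) :: l.tail

theorem runs_prepare (f : α → A) (d : A) (mk : A → A) (e : ℕ) (x : List α) : ∃ y',
    Runs (prepare f d mk e) (mem false d x [] [] [] 0 0 0 0)
      (mem false y' [] (markFirst d mk (x.map f)) [] [] 0 ((x.length + 2) ^ e) 0 0)
      (e * ((x.length + 2) ^ e * (7 * (x.length + 2) + 3) + 2) + 7 * x.length + 20) := by
  obtain ⟨y₀, h⟩ := runs_readInput (fl := false) (y := d) (inp := x) (src := []) (rev := [])
    (out := []) (len := 0) (cnt := 0) (aux := 0) (tmp := 0) f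
  rw [Nat.zero_add] at h
  have h₃ := runs_pour (fl := false) (y := y₀) (inp := ([] : List α)) (src := [])
    (rev := (x.map f).reverse ++ []) (out := []) (len := x.length + 1 + 1) (cnt := 0) (aux := 0)
    (tmp := 0) d
  have e₁ : ((x.map f).reverse ++ []).reverse ++ [] = x.map f := by simp
  have e₂ : ((x.map f).reverse ++ []).length = x.length := by simp
  rw [e₁, e₂] at h₃
  refine ⟨_, (Runs.seq h (Runs.seq (Runs.op apply_inc_len) (Runs.seq (Runs.op apply_inc_len)
    (Runs.seq h₃ (Runs.seq (Runs.op (apply_pop_src d)) (Runs.seq (Runs.op rfl) (Runs.seq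
      (Runs.op apply_push_src) (Runs.seq (Runs.op apply_inc_cnt) (Runs.seq
        (runs_mulPow e (by omega)) runs_clear_len))))))))).mono ?_⟩
  omega

/-- Emit two tables, the second one in front of the first one, and clear the memory. -/
def emitTwoTables (B : ℕ) (f : α → A) (d : A) (mk : A → A) (e : ℕ) (g h₁ h₂ : A → List Item) :
    Program α A :=
  .seq (prepare f d mk e) (.seq (emitTable B d g h₂) (.seq (emitTable B d g h₁)
    (.seq (.loop (.dec .cnt) skip) (.loop (.pop false d) skip))))

/-- A table with `D + 1` blocks. -/
def tableText (B : ℕ) (f g : A → List Item) (w : ℕ → A) (D : ℕ) : List Bool :=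
  expand B D (g (w D)) ++ upperBlocks B f w D

theorem mem_eq_io (d : A) (x : List α) (out : List Bool) :
    mem false d x [] [] out 0 0 0 0 = Memory.io d x out := by
  refine Memory.ext rfl rfl rfl (funext fun i => ?_) rfl (funext fun k => ?_)
  · cases i <;> rfl
  · cases k <;> rfl

theorem runs_emitTwoTables (B : ℕ) (f : α → A) (d : A) (mk : A → A) (e : ℕ)
    (g h₁ h₂ : A → List Item) {L : ℕ} (hg : ∀ a, (g a).length ≤ L) (hh₁ : ∀ a, (h₁ a).length ≤ L)
    (hh₂ : ∀ a, (h₂ a).length ≤ L) (x : List α) {w : ℕ → A}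
    (hw : ∀ j, w j = (markFirst d mk (x.map f)).getD j d) {D : ℕ} (hD : D = (x.length + 2) ^ e) :
    Runs (emitTwoTables B f d mk e g h₁ h₂) (Memory.io d x [])
      (Memory.io d [] (tableText B g h₁ w D ++ tableText B g h₂ w D))
      (e * (D * (7 * (x.length + 2) + 3) + 2) + 9 * x.length +
        2 * ((D + 1) * (L * (D * (B + 5) + 2) + 10)) + 6 * D + 36) := by
  obtain ⟨y₀, hp⟩ := runs_prepare f d mk e x
  rw [← hD] at hp
  obtain ⟨s₁, hr₁, hl₁, hs₁⟩ := runs_emitTable (fl := false) (y := y₀) (inp := ([] : List α))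
    (src := markFirst d mk (x.map f)) (out := []) (len := 0) (cnt := D) B d g h₂ hg hh₂
  obtain ⟨s₂, hr₂, hl₂, -⟩ := runs_emitTable (fl := false) (y := d) (inp := ([] : List α))
    (src := s₁) (out := tableText B g h₂ w D) (len := 0) (cnt := D) B d g h₁ hg hh₁
  have e₀ : (fun j => (markFirst d mk (x.map f)).getD j d) = w := funext fun j => (hw j).symm
  have e₁ : (fun j => s₁.getD j d) = w := funext fun j => (hs₁ j).trans (hw j).symm
  rw [e₀, ← hw, List.append_nil] at hr₁
  rw [e₁, hs₁, ← hw, ← List.append_assoc] at hr₂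
  have hlen : (markFirst d mk (x.map f)).length ≤ x.length + 1 := by
    simp [markFirst]
  have := Runs.seq hp (Runs.seq hr₁ (Runs.seq hr₂ (Runs.seq runs_clear_cnt (runs_clear_src d))))
  rw [mem_eq_io, mem_eq_io] at this
  exact this.mono (by omega)

/-- Two tables whose size is a power of the length of the input are computable in polynomial
time. -/
theorem computable_twoTables [Finite α] [Finite A] (B : ℕ) (f : α → A) (d : A) (mk : A → A)
    (e : ℕ) (g h₁ h₂ : A → List Item) :
    Nonempty (Turing.TM2ComputableInPolyTime (id : List α → List α) (id : List Bool → List Bool)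
      fun x => tableText B g h₁ (fun j => (markFirst d mk (x.map f)).getD j d)
          ((x.length + 2) ^ e) ++
        tableText B g h₂ (fun j => (markFirst d mk (x.map f)).getD j d)
          ((x.length + 2) ^ e)) := by
  obtain ⟨L, hL⟩ : ∃ L, ∀ a, (g a).length ≤ L ∧ (h₁ a).length ≤ L ∧ (h₂ a).length ≤ L := by
    have := Fintype.ofFinite A
    refine ⟨∑ a, ((g a).length + (h₁ a).length + (h₂ a).length), fun a => ?_⟩
    have := Finset.single_le_sum (f := fun a => (g a).length + (h₁ a).length + (h₂ a).length)
      (fun _ _ => Nat.zero_le _) (Finset.mem_univ a)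
    beta_reduce at this
    omega
  have key := runs_emitTwoTables (L := L) B f d mk e g h₁ h₂ (fun a => (hL a).1)
    (fun a => (hL a).2.1) (fun a => (hL a).2.2)
  generalize hp : (Polynomial.X + 2 : Polynomial ℕ) ^ e = p
  refine computable_of_exec (emitTwoTables B f d mk e g h₁ h₂) d _
    (Polynomial.C e * (p * (7 * (Polynomial.X + 2) + 3) + 2) + 9 * Polynomial.X +
      2 * ((p + 1) * (Polynomial.C L * (p * Polynomial.C (B + 5) + 2) + 10)) + 6 * p + 36) ?_
  intro x
  have := key x (fun _ => rfl) rfl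
  obtain ⟨t, ht, he⟩ := this
  refine ⟨t, ht.trans (le_of_eq ?_), he⟩
  subst hp
  simp

end

/-! ### Renaming the states of a transducer -/

/-- The transducer with its states renamed along `e`. -/
def Transducer.rename {α β Q Q' : Type} (T : Transducer α β Q) (e : Q ≃ Q') :
    Transducer α β Q' where
  start := e T.start
  step q a := e (T.step (e.symm q) a)
  label q := T.label (e.symm q)

theorem Transducer.output_rename {α β Q Q' : Type} (T : Transducer α β Q) (e : Q ≃ Q')
    (x : List α) : (T.rename e).output x = T.output x := by
  have h : ∀ q, (T.rename e).outputFrom (e q) x = T.outputFrom q x := by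
    induction x with
    | nil => exact fun _ => rfl
    | cons a x ih =>
      intro q
      simp only [Transducer.outputFrom]
      have hs : (T.rename e).step (e q) a = e (T.step q a) := by simp [Transducer.rename]
      rw [hs, ih]
      simp [Transducer.rename]
  exact h T.start

theorem roundEquivalent_rename {α β Q₁ Q₂ Q₁' Q₂' : Type} [DecidableEq α] [DecidableEq β] {k : ℕ}
    {Λ : Language α} {T₁ : Transducer α β Q₁} {T₂ : Transducer α β Q₂} (e₁ : Q₁ ≃ Q₁')
    (e₂ : Q₂ ≃ Q₂') :
    RoundEquivalent k Λ (T₁.rename e₁) (T₂.rename e₂) ↔ RoundEquivalent k Λ T₁ T₂ := by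
  simp only [RoundEquivalent, RoundSimulates, Transducer.output_rename]

/-! ### Templates for the code of the transducers -/

theorem expand_append (B c : ℕ) (l l' : List Item) :
    expand B c (l ++ l') = expand B c l ++ expand B c l' :=
  List.flatMap_append

theorem expand_flatMap {ι : Type} (B c : ℕ) (l : List ι) (f : ι → List Item) :
    expand B c (l.flatMap f) = l.flatMap fun i => expand B c (f i) := by
  rw [expand, List.flatMap_assoc]
  rfl

/-- The template of the unary code of `n`, to which `B` times the counter is added if `r`. -/
def unaryItems (r : Bool) (n : ℕ) : List Item :=
  (if r then [Item.rep] else []) ++ List.replicate n (Item.lit true) ++ [Item.lit false]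

theorem expand_unaryItems (B c : ℕ) (r : Bool) (n : ℕ) :
    expand B c (unaryItems r n) = unary ((if r then B * c else 0) + n) := by
  have h : expand B c (List.replicate n (Item.lit true)) = List.replicate n true := by
    induction n with
    | zero => rfl
    | succ n ih => rw [List.replicate_succ, List.replicate_succ, ← ih]; rfl
  rw [unaryItems, expand_append, expand_append, h, unary, List.replicate_add]
  cases r <;> simp [expand]

section

variable {α Q G : Type} {D m B : ℕ} (M : TuringMachine α Q G)
  (ins : Fin (m + 1) ≃ Option (Q × G × Bool)) (eP : Fin (m + 1) × Role Q G ≃ Fin B)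

/-- The numbering of the states: the special states come first, then the tokens in the order of
their slots. -/
def stateEquiv (D : ℕ) : SimState D m Q G ≃ Fin (6 + (D + 1) * B) :=
  (Equiv.sumCongr (Equiv.refl _) ((Equiv.prodCongr (Equiv.refl _) eP).trans
    finProdFinEquiv)).trans finSumFinEquiv

theorem stateEquiv_inl (i : Fin 6) : (stateEquiv eP D (Sum.inl i)).val = i := by
  simp [stateEquiv]

theorem stateEquiv_inr (k : Fin (D + 1)) (p : Fin (m + 1) × Role Q G) :
    (stateEquiv eP D (Sum.inr (k, p))).val = 6 + (eP p + B * k) := by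
  simp [stateEquiv]

/-- The template of the number of a target. In slot `k` the counter has the value `k - 1`, and in
slot `0`, for which `z` is `true`, it has the value `D`; in both cases it is the number of the
slot before the current one. -/
def targetItems (z : Bool) : Target m Q G → List Item
  | Sum.inl i => unaryItems false i
  | Sum.inr (Slot.cur, p) =>
    if z then unaryItems false (6 + eP p) else unaryItems true (6 + B + eP p)
  | Sum.inr (Slot.prev, p) => unaryItems true (6 + eP p)
  | Sum.inr (Slot.zero, p) => unaryItems false (6 + eP p)
  | Sum.inr (Slot.one, p) => unaryItems false (6 + B + eP p)

/-- The hypothesis `1 ≤ D` makes the slot `1` different from the slot `0`. -/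
theorem expand_targetItems (hD : 1 ≤ D) (k : Fin (D + 1)) (t : Target m Q G) :
    expand B (k - 1 : Fin (D + 1)).val (targetItems eP (k = 0) t) =
      unary (stateEquiv eP D (t.eval k)) := by
  rcases t with i | ⟨s, p⟩
  · simp [targetItems, expand_unaryItems, Target.eval, stateEquiv_inl]
  · rw [Target.eval, stateEquiv_inr]
    cases s with
    | cur =>
      by_cases hk : k = 0
      · subst hk
        simp [targetItems, expand_unaryItems, Slot.eval]
      · have : k.val ≠ 0 := fun h => hk (Fin.ext h)
        obtain ⟨l, hl⟩ := Nat.exists_eq_succ_of_ne_zero this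
        simp only [targetItems, hk, decide_false, Slot.eval, Fin.val_sub_one_of_ne_zero hk, hl]
        rw [if_neg Bool.false_ne_true, expand_unaryItems]
        congr 1
        simp [Nat.mul_succ]
        ring
    | prev =>
      simp only [targetItems, expand_unaryItems, Slot.eval]
      congr 1
      simp
      ring
    | zero => simp [targetItems, expand_unaryItems, Slot.eval]
    | one =>
      simp only [targetItems, expand_unaryItems, Slot.eval]
      congr 1
      have : (1 : Fin (D + 1)).val = 1 := by
        rw [Fin.val_one', Nat.mod_eq_of_lt (by omega)]
      rw [this]
      simp
      ring

/-- The template of a line of the transition table. -/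
def rowItems (z : Bool) (f : Letter → Target m Q G) (l : Bool) : List Item :=
  targetItems eP z (f Letter.a) ++ targetItems eP z (f Letter.b) ++ targetItems eP z (f Letter.c) ++
    targetItems eP z (f Letter.d) ++ [Item.lit l]

/-- The template of the lines of the tokens in one slot. -/
noncomputable def blockItems (z : Bool) (y : G × Bool) : List Item :=
  (List.finRange B).flatMap fun j => rowItems eP z (tokenTarget M ins z y (eP.symm j)) false

/-- The template of the code of a transducer up to the lines of slot `0`. -/
noncomputable def headItems (i : Fin 6) (y : G × Bool) : List Item :=
  unaryItems true (6 + B) ++ unaryItems false i ++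
    (List.finRange 6).flatMap (fun j => rowItems eP true (specialTarget j) (j = 0)) ++
    blockItems M ins eP true y

/-- The transducer `simTransducer` with numbered states. -/
noncomputable def numbered (D : ℕ) (w : ℕ → G × Bool) (i : Fin 6) :
    Transducer Letter Bool (Fin (6 + (D + 1) * B)) :=
  (simTransducer M ins D w i).rename (stateEquiv eP D)

theorem flatMap_finRange_add {β : Type} (a b : ℕ) (f : Fin (a + b) → List β) :
    (List.finRange (a + b)).flatMap f =
      (List.finRange a).flatMap (fun i => f (Fin.castAdd b i)) ++
        (List.finRange b).flatMap fun i => f (Fin.natAdd a i) := by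
  simp only [List.flatMap_def, ← List.ofFn_eq_map, ← List.flatten_append]
  congr 1
  rw [List.ofFn_add]
  rfl

theorem flatMap_finRange_mul {β : Type} (a b : ℕ) (f : Fin (a * b) → List β) :
    (List.finRange (a * b)).flatMap f =
      (List.finRange a).flatMap fun i => (List.finRange b).flatMap fun j =>
        f (finProdFinEquiv (i, j)) := by
  simp only [List.flatMap_def, ← List.ofFn_eq_map]
  rw [List.ofFn_mul, List.flatten_flatten, List.map_ofFn]
  congr 2
  funext i
  simp only [Function.comp]
  congr 2
  funext j
  congr 1
  ext
  simp [Nat.mul_comm, Nat.add_comm]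

variable {w : ℕ → G × Bool} {i : Fin 6}

theorem encodeRow_special (hD : 1 ≤ D) (j : Fin 6) :
    encodeRow (numbered M ins eP D w i) (stateEquiv eP D (Sum.inl j)) =
      expand B D (rowItems eP true (specialTarget j) (j = 0)) := by
  have h : ∀ l, unary ((numbered M ins eP D w i).step
      (stateEquiv eP D (Sum.inl j)) l).val =
        expand B D (targetItems eP true (specialTarget j l)) := by
    intro l
    have := expand_targetItems eP hD 0 (specialTarget j l)
    rw [zero_sub_one_eq_last, Fin.val_last] at this
    simp only [decide_true] at this
    rw [this]
    simp [numbered, Transducer.rename, simTransducer]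
  rw [encodeRow, h, h, h, h, rowItems, expand_append, expand_append, expand_append, expand_append]
  simp [numbered, Transducer.rename, simTransducer, expand]

theorem encodeRow_token (hD : 1 ≤ D) (k : Fin (D + 1)) (p : Fin (m + 1) × Role Q G) :
    encodeRow (numbered M ins eP D w i) (stateEquiv eP D (Sum.inr (k, p))) =
      expand B (k - 1 : Fin (D + 1)).val
        (rowItems eP (k = 0) (tokenTarget M ins (k = 0) (w (D - k)) p) false) := by
  have h : ∀ l, unary ((numbered M ins eP D w i).step
      (stateEquiv eP D (Sum.inr (k, p))) l).val = expand B (k - 1 : Fin (D + 1)).val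
        (targetItems eP (k = 0) (tokenTarget M ins (k = 0) (w (D - k)) p l)) := by
    intro l
    rw [expand_targetItems eP hD]
    simp [numbered, Transducer.rename, simTransducer]
  rw [encodeRow, h, h, h, h, rowItems, expand_append, expand_append, expand_append, expand_append]
  simp [numbered, Transducer.rename, simTransducer, expand]

/-- The code of the transducer is a table with one block for each slot, in which the contents of
the tape are the only part that depends on the input of the machine. -/
theorem encodeTransducer_sim (hD : 1 ≤ D) :
    encodeTransducer ⟨_, numbered M ins eP D w i⟩ =
      tableText B (blockItems M ins eP false) (headItems M ins eP i) w D := by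
  have hstart : ((numbered M ins eP D w i).start).val = i := by
    simp [numbered, Transducer.rename, simTransducer, stateEquiv_inl]
  have hspecial : ∀ j : Fin 6, (Fin.castAdd ((D + 1) * B) j) =
      stateEquiv eP D (Sum.inl j) := fun j => Fin.ext (by simp [stateEquiv_inl])
  have htoken : ∀ (k : Fin (D + 1)) (j : Fin B), (Fin.natAdd 6 (finProdFinEquiv (k, j))) =
      stateEquiv eP D (Sum.inr (k, eP.symm j)) := fun k j => Fin.ext (by simp [stateEquiv_inr])
  have htable : (List.finRange (6 + (D + 1) * B)).flatMap
      (encodeRow (numbered M ins eP D w i)) =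
      expand B D ((List.finRange 6).flatMap
        (fun j => rowItems eP true (specialTarget j) (j = 0))) ++
      (expand B D (blockItems M ins eP true (w D)) ++
        upperBlocks B (blockItems M ins eP false) w D) := by
    rw [flatMap_finRange_add, flatMap_finRange_mul]
    simp only [hspecial, htoken]
    simp only [encodeRow_special M ins eP hD, encodeRow_token M ins eP hD]
    rw [expand_flatMap, List.finRange_succ (n := D), List.flatMap_cons, blockItems, expand_flatMap]
    congr 2
    · rw [zero_sub_one_eq_last, Fin.val_last]
      simp
    · rw [upperBlocks, ← List.map_coe_finRange_eq_range, List.flatMap_map, List.flatMap_map]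
      congr 1
      funext c
      have hc : c.succ ≠ 0 := Fin.succ_ne_zero c
      rw [Fin.val_sub_one_of_ne_zero hc]
      simp only [hc, decide_false, Fin.val_succ, Nat.add_sub_cancel, blockItems, expand_flatMap]
      rw [show D - (c.val + 1) = D - 1 - c.val by omega]
  change unary (6 + (D + 1) * B) ++ unary (numbered M ins eP D w i).start ++ _ = _
  rw [hstart, htable, tableText, headItems, expand_append, expand_append, expand_append,
    expand_unaryItems, expand_unaryItems, show 6 + (D + 1) * B = B * D + (6 + B) by ring]
  simp

end

/-! ### Hardness -/

theorem exists_pow_bound (p : Polynomial ℕ) : ∃ e, ∀ n, p.eval n ≤ (n + 2) ^ e := by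
  induction p using Polynomial.induction_on' with
  | add p q hp hq =>
    obtain ⟨a, ha⟩ := hp
    obtain ⟨b, hb⟩ := hq
    refine ⟨max a b + 1, fun n => ?_⟩
    have h₁ : (n + 2) ^ a ≤ (n + 2) ^ max a b :=
      Nat.pow_le_pow_right (by omega) (le_max_left _ _)
    have h₂ : (n + 2) ^ b ≤ (n + 2) ^ max a b :=
      Nat.pow_le_pow_right (by omega) (le_max_right _ _)
    have := ha n
    have := hb n
    rw [Polynomial.eval_add, pow_succ]
    nlinarith
  | monomial k c =>
    refine ⟨c + k, fun n => ?_⟩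
    rw [Polynomial.eval_monomial, pow_add]
    have : c ≤ (n + 2) ^ c := (Nat.lt_pow_self (by omega)).le
    gcongr
    omega

/-- The buffer prepared by the program holds the initial tape. -/
theorem markFirst_getD {α Q G : Type} (M : TuringMachine α Q G) (x : List α) (j : ℕ) :
    (markFirst (M.blank, false) (fun y => (y.1, true))
      (x.map fun a => (M.input a, false))).getD j (M.blank, false) =
      ((M.init x).tape j, decide (j = 0)) := by
  cases x with
  | nil => cases j <;> simp [markFirst, TuringMachine.init]
  | cons a x =>
    cases j with
    | zero => simp [markFirst, TuringMachine.init]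
    | succ j =>
      simp only [markFirst, TuringMachine.init, List.map_cons, List.tail_cons,
        List.getD_eq_getElem?_getD, List.getElem?_map, List.getElem?_cons_succ]
      cases x[j]? <;> simp

theorem mem_iff_forall_ne_reject {α Q G : Type} {M : TuringMachine α Q G} {L : Language α}
    (hM : M.Decides L) (x : List α) : x ∈ L ↔ ∀ t, (M.run x t).state ≠ M.reject := by
  constructor
  · intro hx t ht
    obtain ⟨s, hs⟩ := (hM x).1 hx
    have h₁ : M.run x (s + t) = M.run x t := by
      rw [TuringMachine.run, Function.iterate_add_apply]
      exact iterate_step_of_halted (Or.inr ht) s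
    have h₂ : M.run x (s + t) = M.run x s := by
      rw [TuringMachine.run, Nat.add_comm, Function.iterate_add_apply]
      exact iterate_step_of_halted (Or.inl hs) t
    exact M.accept_ne_reject (by rw [← hs, ← h₂, h₁, ht])
  · intro h
    by_contra hx
    obtain ⟨t, ht⟩ := (hM x).2 hx
    exact h t ht

theorem mem_roundEquivProblem {k : ℕ} {Λ : Language Letter} {S₁ S₂ : FinTransducer} :
    encodeTransducer S₁ ++ encodeTransducer S₂ ∈ roundEquivProblem k Λ ↔
      RoundEquivalent k Λ S₁.T S₂.T := by
  constructor
  · rintro ⟨S₁', S₂', h, hS⟩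
    obtain ⟨rfl, h⟩ := encodeTransducer_append_inj h
    obtain ⟨rfl, -⟩ := encodeTransducer_append_inj (u := []) (v := []) (by simpa using h)
    exact hS
  · exact fun h => ⟨S₁, S₂, rfl, h⟩

theorem pspaceHard_roundEquivProblem : PSPACEHard (roundEquivProblem 2 abcdStar) := by
  intro α _ L hL
  obtain ⟨Q, G, _, _, M, p, hM, hspace⟩ := hL
  obtain ⟨e, he⟩ := exists_pow_bound p
  have := Fintype.ofFinite Q
  have := Fintype.ofFinite G
  -- The instruction with number `0` is the one that is never fired legitimately.
  let ins : Fin (Fintype.card (Q × G × Bool) + 1) ≃ Option (Q × G × Bool) :=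
    (finSuccEquiv _).trans (Equiv.optionCongr (Fintype.equivFin (Q × G × Bool)).symm)
  have hins : ins 0 = none := by simp [ins]
  let eP := Fintype.equivFin (Fin (Fintype.card (Q × G × Bool) + 1) × Role Q G)
  refine ⟨_, computable_twoTables (Fintype.card (Fin (Fintype.card (Q × G × Bool) + 1) × Role Q G))
    (fun a => (M.input a, false)) (M.blank, false) (fun y => (y.1, true)) e
    (blockItems M ins eP false) (headItems M ins eP 2) (headItems M ins eP 3), fun x => ?_⟩
  have hD : 1 ≤ (x.length + 2) ^ e := Nat.one_le_pow _ _ (by omega)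
  rw [← encodeTransducer_sim M ins eP hD, ← encodeTransducer_sim M ins eP hD,
    mem_roundEquivProblem, mem_iff_forall_ne_reject hM]
  refine Iff.trans ?_ (roundEquivalent_rename _ _).symm
  rw [roundEquivalent_iff_survives]
  exact (forall_survives_iff hins x (fun j _ => markFirst_getD M x j)
    fun t => (hspace x t).trans_le ((he _).trans (Nat.le_succ _))).symm

end RoundSim

theorem mainTheorem4 :
    ∃ D : DFA RoundSim.Letter (Fin 4), D.accepts = RoundSim.abcdStar ∧
      RoundSim.PSPACEHard (RoundSim.roundEquivProblem 2 D.accepts) := by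
  refine ⟨RoundSim.abcdDFA, RoundSim.abcdDFA_accepts, ?_⟩
  rw [RoundSim.abcdDFA_accepts]
  exact RoundSim.pspaceHard_roundEquivProblem
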